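/- Let $K$ be a number field with ring of integers $\mathfrak{o}_K$ and algebraic closure $\overline{K}$; for each archimedean place $v$ let $K_v$ be the completion, and fix a $K$-embedding of $\overline{K}$ into an algebraic closure $\overline{K_v}$ of $K_v$. Let $X$ be a smooth, projective, geometrically integral $K$-variety, and let $D$ be a reduced effective divisor on $X$ with strict normal crossings such that all irreducible components of $D_{\overline{K}}$ are defined over $K$. Let $U=X\setminus D$, and let $\mathfrak{U}$ be an integral model of $U$, that is, a flat separated $\mathfrak{o}_K$-scheme of finite type together with an isomorphism of $K$-schemes between its generic fiber and $U$. We regard $\mathfrak{U}(\mathfrak{o}_K)$ as a subset of $U(K)\subset X(K)\subset X(K_v)$. Let $(D_\alpha)_{\alpha\in\mathcal{A}}$ be the irreducible components of $D$. For an archimedean place $v$, the $K_v$-analytic Clemens complex $\mathcal{C}^{\mathrm{an}}_v(D)$ is the set of all pairs $(A,Z)$, where $A\subset\mathcal{A}$ is a subset (possibly empty) and $Z$ is an irreducible component of $\bigl(\bigcap_{\alpha\in A}D_\alpha\bigr)_{\overline{K}}$ (the empty intersection being $X$) that is defined over $K_v$ and has a $K_v$-rational point; it is ordered by $(A,Z)\preceq(A',Z')$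 if $A\subset A'$ and $Z\supset Z'$. We abbreviate such a face to $A$ and write $Z_A=Z$ for its stratum. Let $\mathcal{C}^{\mathrm{an}}_\infty(D)=\prod_{v\mid\infty}\mathcal{C}^{\mathrm{an}}_v(D)$. For a face $\boldsymbol{A}=(A_v)_{v\mid\infty}$ in it, put $$\Delta_{\boldsymbol{A}}=\sum_{\alpha\notin A_v\text{ for all }v\mid\infty}D_\alpha\qquad\text{and}\qquad U_{\boldsymbol{A}}=X\setminus\Delta_{\boldsymbol{A}}.$$ Let $\boldsymbol{A}\in\mathcal{C}^{\mathrm{an}}_\infty(D)$ be a (not necessarily maximal) face such that $\mathcal{O}_X(U_{\boldsymbol{A}})\neq K$. For each $v\mid\infty$, let $B_{v,1},\dots,B_{v,r_v}\in\mathcal{C}^{\mathrm{an}}_v(D)$ be the faces strictly larger than $A_v$, and for each $1\le i\le r_v$ let $W_{v,i}\subset X(K_v)$ be an arbitrary neighborhood of $Z_{B_{v,i}}(K_v)$ in the analytic topology. Then there exist, for each $v\mid\infty$, an analytic neighborhood $U_v\subset X(K_v)$ of $$Z_{A_v}(K_v)\setminus\bigcup_{i=1}^{r_v}W_{v,i}$$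 and a Zariski dense open subvariety $V\subset X$ such that $$\{x\in\mathfrak{U}(\mathfrak{o}_K)\cap V(K)\mid x\in U_v\text{ for all }v\mid\infty\}=\emptyset.$$ -/

import Mathlib

open CategoryTheory CategoryTheory.Limits AlgebraicGeometry TopologicalSpace NumberField Topology

universe u

namespace LogPair

noncomputable section

/-! ## Varieties over a field: projectivity, rational points, the analytic topology -/

attribute [local instance] MvPolynomial.gradedAlgebra

/-- A `K`-scheme `f : X ⟶ Spec K` is projective if it admits a closed immersion over `K`
into some projective space `ℙⁿ_K = Proj K[x₀, …, xₙ]`. -/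
def IsProjectiveOver {K : Type u} [Field K] {X : Scheme.{u}} (f : X ⟶ Spec (.of K)) : Prop :=
  ∃ (n : ℕ) (i : X ⟶ Proj (MvPolynomial.homogeneousSubmodule (Fin (n + 1)) K)),
    IsClosedImmersion i ∧
      i ≫ Proj.toSpecZero (MvPolynomial.homogeneousSubmodule (Fin (n + 1)) K) ≫
        Spec.map (CommRingCat.ofHom
          (algebraMap K (MvPolynomial.homogeneousSubmodule (Fin (n + 1)) K 0))) = f

/-- The morphism `Spec B ⟶ Spec A` of an `A`-algebra `B`. -/
abbrev specMap (A B : Type u) [CommRing A] [CommRing B] [Algebra A B] :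
    Spec (.of B) ⟶ Spec (.of A) :=
  Spec.map (CommRingCat.ofHom (algebraMap A B))

/-- The set `X(L)` of `L`-rational points of a `K`-scheme `X`, for a `K`-algebra `L`. -/
@[ext]
structure Pt {K : Type u} [Field K] {X : Scheme.{u}} (f : X ⟶ Spec (.of K))
    (L : Type u) [Field L] [Algebra K L] : Type u where
  /-- the underlying morphism of schemes -/
  hom : Spec (.of L) ⟶ X
  comp_eq : hom ≫ f = specMap K L

/-- The map `X(K) → X(L)`. -/
def Pt.extend {K : Type u} [Field K] {X : Scheme.{u}} {f : X ⟶ Spec (.of K)}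
    (x : Pt f K) (L : Type u) [Field L] [Algebra K L] : Pt f L :=
  ⟨specMap K L ≫ x.hom, by
    rw [Category.assoc, x.comp_eq]
    simp only [specMap, Algebra.algebraMap_self, CommRingCat.ofHom_id, Spec.map_id]
    exact Category.comp_id _⟩

/-- The value `h(x) ∈ L` of a regular function `h` on `U` at an `L`-point `x` of `U`. -/
def evalAt {X : Scheme.{u}} {L : Type u} [Field L] (x : Spec (.of L) ⟶ X) (U : X.Opens)
    (hx : ⊤ ≤ x ⁻¹ᵁ U) (h : Γ(X, U)) : L :=
  (Scheme.ΓSpecIso (.of L)).hom (x.appLE U ⊤ hx h)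

/-- The analytic topology on `X(L)` for a topological field `L`: it is generated by the sets
`{x ∈ U(L) | h(x) ∈ O}` with `U ⊆ X` Zariski open, `h` a regular function on `U` and
`O ⊆ L` open. -/
instance analyticTopology {K : Type u} [Field K] {X : Scheme.{u}} (f : X ⟶ Spec (.of K))
    (L : Type u) [Field L] [Algebra K L] [TopologicalSpace L] : TopologicalSpace (Pt f L) :=
  TopologicalSpace.generateFrom
    {S | ∃ (U : X.Opens) (h : Γ(X, U)) (O : Set L), IsOpen O ∧
      S = {x : Pt f L | ∃ hx : ⊤ ≤ x.hom ⁻¹ᵁ U, evalAt x.hom U hx h ∈ O}}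

/-- The ring homomorphism `K → 𝒪_X(U)` embedding the constants. -/
def constants {K : Type u} [Field K] {X : Scheme.{u}} (f : X ⟶ Spec (.of K)) (U : X.Opens) :
    K →+* Γ(X, U) :=
  ((Scheme.ΓSpecIso (.of K)).inv ≫ f.appLE ⊤ U le_top).hom

/-- The base change `X_L` of a `K`-scheme `X`. -/
abbrev baseChange {K : Type u} [Field K] {X : Scheme.{u}} (f : X ⟶ Spec (.of K))
    (L : Type u) [Field L] [Algebra K L] : Scheme.{u} :=
  pullback f (specMap K L)

/-- The preimage in `X_L` of a closed subset of `X`. -/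
def closedBaseChange {K : Type u} [Field K] {X : Scheme.{u}} (f : X ⟶ Spec (.of K))
    (L : Type u) [Field L] [Algebra K L] (C : Closeds X) : Closeds (baseChange f L) :=
  C.preimage (pullback.fst f (specMap K L)).continuous

/-! ## Strict normal crossings divisors -/

/-- The irreducible components of a closed subset `T`: its maximal irreducible closed subsets. -/
def components {T : Type u} [TopologicalSpace T] (D : Closeds T) : Set (Closeds T) :=
  {C | Maximal (fun C : Closeds T => IsIrreducible (C : Set T) ∧ C ≤ D) C}

/-- The intersection `Z_A = ⋂_{α ∈ A} D_α` of a set of closed subsets (with `Z_∅ = X`). -/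
def stratum {X : Scheme.{u}} (A : Set (Closeds X)) : Closeds X := sInf A

/-- The ideal sheaf of the scheme-theoretic intersection of the reduced closed subschemes
with underlying sets in `A`. -/
def stratumIdeal {X : Scheme.{u}} (A : Set (Closeds X)) : X.IdealSheafData :=
  ⨆ α ∈ A, Scheme.IdealSheafData.vanishingIdeal α

/-- A reduced effective divisor on a smooth variety `X` over a field `K` of characteristic `0`
is given by its support `D`, a closed subset of pure codimension one. It has strict normal
crossings if for every set `A` of irreducible components of `D`, the scheme-theoretic
intersection of the members of `A` is smooth over `K` and of pure codimension `#A` in `X`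
(it may be empty). The sets `A` with one element give that `D` has pure codimension one. -/
def IsSNCDivisor {K : Type u} [Field K] {X : Scheme.{u}} (f : X ⟶ Spec (.of K))
    (D : Closeds X) : Prop :=
  ∀ A : Set (Closeds X), A ⊆ components D →
    Smooth ((stratumIdeal A).subschemeι ≫ f) ∧
    ∀ C ∈ components (stratum A), ∀ z : X, IsGenericPoint z (C : Set X) →
      ringKrullDim (X.presheaf.stalk z) = (A.encard : WithBot ℕ∞)

/-- All irreducible components of `D_{Kbar}` are defined over `K`. -/
def ComponentsDefinedOver {K : Type u} [Field K] {X : Scheme.{u}} (f : X ⟶ Spec (.of K))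
    (D : Closeds X) (Kbar : Type u) [Field Kbar] [Algebra K Kbar] : Prop :=
  ∀ C ∈ components (closedBaseChange f Kbar D), ∃ Y : Closeds X, C = closedBaseChange f Kbar Y

/-! ## Clemens complexes -/

/-- A face `(A, Z)` of the geometric Clemens complex of `D`: a set `A` of irreducible components
of `D` together with an irreducible component `Z` of `(Z_A)_{Kbar}`. -/
@[ext]
structure GeomFace {K : Type u} [Field K] {X : Scheme.{u}} (f : X ⟶ Spec (.of K))
    (D : Closeds X) (Kbar : Type u) [Field Kbar] [Algebra K Kbar] where
  /-- the set `A` of components of `D` -/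
  verts : Set (Closeds X)
  /-- the component `Z` of the stratum -/
  carrier : Closeds (baseChange f Kbar)
  verts_subset : verts ⊆ components D
  carrier_mem : carrier ∈ components (closedBaseChange f Kbar (stratum verts))

/-- `(A, Z) ≼ (A', Z')` if `A ⊆ A'` and `Z ⊇ Z'`. -/
instance {K : Type u} [Field K] {X : Scheme.{u}} (f : X ⟶ Spec (.of K))
    (D : Closeds X) (Kbar : Type u) [Field Kbar] [Algebra K Kbar] :
    PartialOrder (GeomFace f D Kbar) where
  le F G := F.verts ⊆ G.verts ∧ G.carrier ≤ F.carrier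
  le_refl _ := ⟨subset_rfl, le_rfl⟩
  le_trans _ _ _ h h' := ⟨h.1.trans h'.1, h'.2.trans h.2⟩
  le_antisymm _ _ h h' := GeomFace.ext (h.1.antisymm h'.1) (le_antisymm h'.2 h.2)

section Places

variable {K : Type u} [Field K] {X : Scheme.{u}}

/-- The morphism `Spec Ω ⟶ X_{Kbar}` underlying an `L`-point of `X`, where
`Ω` is the algebraic closure of `L` and `σ : Kbar → Ω` a fixed embedding. -/
def Pt.geom {f : X ⟶ Spec (.of K)} {L : Type u} [Field L] [Algebra K L]
    {Kbar : Type u} [Field Kbar] [Algebra K Kbar]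
    (σ : Kbar →ₐ[K] AlgebraicClosure L) (x : Pt f L) :
    Spec (.of (AlgebraicClosure L)) ⟶ baseChange f Kbar :=
  pullback.lift (specMap L (AlgebraicClosure L) ≫ x.hom)
    (Spec.map (CommRingCat.ofHom σ.toRingHom)) (by
      rw [Category.assoc, x.comp_eq, ← Spec.map_comp, ← Spec.map_comp, ← CommRingCat.ofHom_comp,
        ← CommRingCat.ofHom_comp]
      congr 2
      ext a
      simp [← IsScalarTower.algebraMap_apply])

/-- The set `Z(L) ⊆ X(L)` for a closed subset `Z` of `X_{Kbar}`. -/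
def ratPts {f : X ⟶ Spec (.of K)} {L : Type u} [Field L] [Algebra K L]
    {Kbar : Type u} [Field Kbar] [Algebra K Kbar]
    (σ : Kbar →ₐ[K] AlgebraicClosure L) (Z : Closeds (baseChange f Kbar)) : Set (Pt f L) :=
  {x | Set.range (x.geom σ) ⊆ (Z : Set (baseChange f Kbar))}

/-- The projection `X_Ω ⟶ X_{Kbar}` induced by `σ : Kbar → Ω`. -/
def baseChangeMap (f : X ⟶ Spec (.of K)) {L Ω : Type u} [Field L] [Algebra K L]
    [Field Ω] [Algebra K Ω] (σ : L →ₐ[K] Ω) : baseChange f Ω ⟶ baseChange f L :=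
  pullback.map f (specMap K Ω) f (specMap K L) (𝟙 X)
    (Spec.map (CommRingCat.ofHom σ.toRingHom)) (𝟙 _) (by simp) (by
      rw [Category.comp_id, ← Spec.map_comp, ← CommRingCat.ofHom_comp]
      exact congrArg (fun φ => Spec.map (CommRingCat.ofHom φ)) σ.comp_algebraMap.symm)

/-- A closed subset `Z` of `X_{Kbar}` is defined over `L` if its base change to the algebraic
closure of `L` (along `σ`) is the base change of a closed subset of `X_L`. -/
def DefinedOver {f : X ⟶ Spec (.of K)} {L : Type u} [Field L] [Algebra K L]
    {Kbar : Type u} [Field Kbar] [Algebra K Kbar]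
    (σ : Kbar →ₐ[K] AlgebraicClosure L) (Z : Closeds (baseChange f Kbar)) : Prop :=
  ∃ Y : Closeds (baseChange f L),
    Z.preimage (baseChangeMap f σ).continuous =
      Y.preimage (baseChangeMap f (IsScalarTower.toAlgHom K L (AlgebraicClosure L))).continuous

/-- The `L`-analytic Clemens complex: the faces `(A, Z)` such that `Z` is defined over `L` and
has an `L`-rational point, with the induced order. -/
abbrev AnFace (f : X ⟶ Spec (.of K)) (D : Closeds X) {L : Type u} [Field L] [Algebra K L]
    {Kbar : Type u} [Field Kbar] [Algebra K Kbar]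
    (σ : Kbar →ₐ[K] AlgebraicClosure L) : Type u :=
  {F : GeomFace f D Kbar // DefinedOver σ F.carrier ∧ (ratPts σ F.carrier).Nonempty}

/-- The archimedean analytic Clemens complex: the product of the `K_v`-analytic Clemens complexes
over all archimedean places `v`. -/
abbrev ArchFace (f : X ⟶ Spec (.of K)) (D : Closeds X)
    {Kbar : Type u} [Field Kbar] [Algebra K Kbar]
    (σ : ∀ v : InfinitePlace K, Kbar →ₐ[K] AlgebraicClosure v.Completion) : Type u :=
  ∀ v : InfinitePlace K, AnFace f D (σ v)

/-- `U_A = X ∖ Δ_A`, where `Δ_A` is the union of the components of `D` which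
belong to none of the `A_v`. -/
def openOfFace {f : X ⟶ Spec (.of K)} {D : Closeds X}
    {Kbar : Type u} [Field Kbar] [Algebra K Kbar]
    {σ : ∀ v : InfinitePlace K, Kbar →ₐ[K] AlgebraicClosure v.Completion}
    (A : ArchFace f D σ) : X.Opens :=
  (sSup {α ∈ components D | ∀ v, α ∉ (A v).1.verts}).compl

end Places

/-! ## Integral models and integral points -/

/-- The open subvariety `U = X ∖ D`. -/
abbrev openCompl {X : Scheme.{u}} (D : Closeds X) : X.Opens := D.compl

/-- An integral model of `U = X ∖ D`: a flat separated `𝓞 K`-scheme of finite type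
together with an isomorphism over `K` of its generic fibre with `U`. -/
structure IntegralModel {K : Type u} [Field K] {X : Scheme.{u}} (f : X ⟶ Spec (.of K))
    (D : Closeds X) where
  /-- the total space -/
  scheme : Scheme.{u}
  /-- the structure morphism -/
  str : scheme ⟶ Spec (.of (𝓞 K))
  flat : Flat str
  separated : IsSeparated str
  locallyOfFiniteType : LocallyOfFiniteType str
  quasiCompact : QuasiCompact str
  /-- the identification of the generic fibre with `U` -/
  genericFibre : pullback str (specMap (𝓞 K) K) ≅ (openCompl D).toScheme
  overBase : genericFibre.hom ≫ (openCompl D).ι ≫ f = pullback.snd str (specMap (𝓞 K) K)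

/-- An integral point: a section of the structure morphism `𝔘 ⟶ Spec (𝓞 K)`. -/
structure IntegralModel.IntPt {K : Type u} [Field K] {X : Scheme.{u}} {f : X ⟶ Spec (.of K)}
    {D : Closeds X} (M : IntegralModel f D) : Type u where
  /-- the underlying morphism of schemes -/
  hom : Spec (.of (𝓞 K)) ⟶ M.scheme
  comp_eq : hom ≫ M.str = 𝟙 _

/-- The `K`-rational point of the generic fibre given by an integral point. -/
def IntegralModel.generic {K : Type u} [Field K] {X : Scheme.{u}} {f : X ⟶ Spec (.of K)}
    {D : Closeds X} (M : IntegralModel f D) (s : M.IntPt) :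
    Spec (.of K) ⟶ pullback M.str (specMap (𝓞 K) K) :=
  pullback.lift (specMap (𝓞 K) K ≫ s.hom) (𝟙 _)
    (by rw [Category.assoc, s.comp_eq, Category.comp_id, Category.id_comp])

/-- The `K`-rational point of `X` given by an integral point. -/
def IntegralModel.toPt {K : Type u} [Field K] {X : Scheme.{u}} {f : X ⟶ Spec (.of K)}
    {D : Closeds X} (M : IntegralModel f D) (s : M.IntPt) : Pt f K :=
  ⟨M.generic s ≫ M.genericFibre.hom ≫ (openCompl D).ι, by
    rw [Category.assoc, Category.assoc, M.overBase, generic, pullback.lift_snd]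
    simp only [specMap, Algebra.algebraMap_self, CommRingCat.ofHom_id, Spec.map_id]⟩

end

end LogPair

open LogPair

/-! Choose a non-constant regular function `h` on `U_A`. Integral points lie in `U ⊆ U_A`, and
`Γ(U)` is generated by functions of the model together with constants of `K`. Hence a single nonzero
`a : 𝓞 K` makes `a * h(x)` integral for every integral point `x`
(`IntegralModel.exists_mul_evalHom_toPt_eq`).

At each archimedean `v`, remove from the stratum of `A_v` the interiors of the neighborhoods of the
larger strata. What remains is compact (`compactSpace_pt`, `isClosed_ratPts`), and `h` is defined on
it: a `K_v`-point of the stratum lying on a further component of `D` lies on the stratum of a larger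
face (`exists_lt_mem_ratPts`), so it was removed. Thus `|h|_v` is bounded on a neighborhood
(`exists_mem_nhdsSet_norm_evalHom_lt`).

A number field has only finitely many elements with bounded denominator and bounded archimedean
absolute values, so `h` takes finitely many values at the integral points in question. Let `V` be
the locus where `h` avoids these values.

The larger face must belong to the analytic Clemens complex, that is, the component of the stratum
through the rational point must be defined over `K_v` (`definedOver_of_mem`). This rests on
smoothness: local rings of smooth schemes are domains, so distinct components of a stratum are
disjoint, also after base change. -/

open LogPair

/-! ### Local rings of smooth schemes over a field are domains -/

section CommutativeAlgebra

open TensorProduct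

/-- In a reduced Artinian ring, a vanishing product is split by an idempotent. -/
lemma exists_isIdempotentElem_of_mul_eq_zero {Q : Type*} [CommRing Q] [IsArtinianRing Q]
    [IsReduced Q] {a b : Q} (h : a * b = 0) :
    ∃ e : Q, IsIdempotentElem e ∧ e * b = 0 ∧ (1 - e) * a = 0 := by
  classical
  let φ := IsArtinianRing.equivPi Q
  have hm (m : MaximalSpectrum Q) : φ a m = 0 ∨ φ b m = 0 := by
    have : φ a m * φ b m = 0 := by
      rw [← Pi.mul_apply, ← map_mul, h, map_zero, Pi.zero_apply]
    exact mul_eq_zero.mp this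
  -- `Q` is a finite product of fields; the idempotent is the indicator of the coordinates where `a`
  -- is nonzero, and `b` vanishes there.
  refine ⟨φ.symm fun m ↦ if φ a m = 0 then 0 else 1, ?_, ?_, ?_⟩
  · apply φ.injective
    rw [map_mul, AlgEquiv.apply_symm_apply]
    ext m
    by_cases hb : φ a m = 0 <;> simp [hb]
  · apply φ.injective
    rw [map_mul, AlgEquiv.apply_symm_apply, map_zero]
    ext m
    rcases hm m with hb | hb <;> simp [hb]
  · apply φ.injective
    rw [map_mul, map_sub, map_one, AlgEquiv.apply_symm_apply, map_zero]
    ext m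
    by_cases hb : φ a m = 0 <;> simp [hb]

lemma IsIdempotentElem.isIntegral {R S : Type*} [CommRing R] [CommRing S] [Algebra R S] {e : S}
    (he : IsIdempotentElem e) : _root_.IsIntegral R e := by
  refine ⟨Polynomial.X ^ 2 - Polynomial.X,
    Polynomial.monic_X_pow_sub (n := 2) (Polynomial.degree_X_le.trans_lt (by norm_num)), ?_⟩
  rw [Polynomial.eval₂_sub, Polynomial.eval₂_pow, Polynomial.eval₂_X, sq, he.eq, sub_self]

/-- In an étale algebra over an integrally closed domain, a vanishing product is split by an
element. -/
lemma exists_mul_eq_zero_of_etale {P B : Type*} [CommRing P] [IsDomain P] [IsIntegrallyClosed P]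
    [CommRing B] [Algebra P B] [Algebra.Etale P B] {a b : B} (h : a * b = 0) :
    ∃ e : B, e * b = 0 ∧ (1 - e) * a = 0 := by
  -- Over the generic point of `P` the algebra is finite and reduced, so the product is split by an
  -- idempotent there. The remaining task is to descend this idempotent to `B`, which embeds in `Q`
  -- by flatness.
  let F := FractionRing P
  let Q := F ⊗[P] B
  have : Algebra.FormallyUnramified F Q := inferInstance
  have : Module.Finite F Q := Algebra.FormallyUnramified.finite_of_free F Q
  have : IsArtinianRing Q := IsArtinianRing.of_finite F Q
  have : IsReduced Q := Algebra.FormallyUnramified.isReduced_of_field F Q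
  let ι : B →ₐ[P] Q := Algebra.TensorProduct.includeRight
  have hι : Function.Injective ι :=
    Algebra.TensorProduct.includeRight_injective (IsFractionRing.injective P F)
  obtain ⟨e, he, h1, h2⟩ := exists_isIdempotentElem_of_mul_eq_zero (a := ι a) (b := ι b)
    (by rw [← map_mul, h, map_zero])
  let e' : B ⊗[P] F := Algebra.TensorProduct.comm P F B e
  have he' : IsIntegral B e' :=
    (he.map (Algebra.TensorProduct.comm P F B)).isIntegral
  -- Integral closure commutes with smooth base change, so the idempotent, being integral over `B`,
  -- comes from `B ⊗ (integral closure of P in F)`. That is `B`, because `P` is integrally closed.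
  obtain ⟨t, ht⟩ :=
    (TensorProduct.toIntegralClosure_bijective_of_smooth (R := P) (S := B) (B := F)).2 ⟨e', he'⟩
  obtain ⟨e₀, rfl⟩ : ∃ e₀ : B, ι e₀ = e := by
    obtain ⟨e₀, he₀⟩ : ∃ e₀ : B, e' = e₀ ⊗ₜ 1 := by
      have ht' : (TensorProduct.toIntegralClosure P B F t : B ⊗[P] F) = e' := by rw [ht]
      rw [← ht']
      clear ht ht'
      induction t with
      | zero => exact ⟨0, by simp⟩
      | add x y hx hy =>
        obtain ⟨x', hx'⟩ := hx
        obtain ⟨y', hy'⟩ := hy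
        exact ⟨x' + y', by rw [map_add, TensorProduct.add_tmul, ← hx', ← hy']; rfl⟩
      | tmul x y =>
        obtain ⟨y', hy'⟩ := IsIntegrallyClosed.isIntegral_iff.mp y.2
        refine ⟨y' • x, ?_⟩
        have : (TensorProduct.toIntegralClosure P B F (x ⊗ₜ y) : B ⊗[P] F) = x ⊗ₜ y.1 := by
          simp [TensorProduct.toIntegralClosure]
        rw [this, ← hy', Algebra.algebraMap_eq_smul_one, TensorProduct.smul_tmul]
    exact ⟨e₀, (Algebra.TensorProduct.comm P F B).injective (by
      change _ = e'
      rw [he₀]; exact Algebra.TensorProduct.comm_tmul ..)⟩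
  refine ⟨e₀, hι (by rw [map_mul, h1, map_zero]), hι (by rw [map_mul, map_sub, map_one, h2, map_zero])⟩

/-- The local rings of a smooth algebra over a field are domains. -/
lemma isDomain_localization_atPrime_of_smooth {k A : Type*} [Field k] [CommRing A] [Algebra k A]
    [Algebra.Smooth k A] (p : Ideal A) [p.IsPrime] : IsDomain (Localization.AtPrime p) := by
  obtain ⟨f, hf, n, _, _, _⟩ :=
    Algebra.IsSmoothAt.exists_isStandardEtale_mvPolynomial (R := k) (p := p)
  have hmk (x : A) (y : p.primeCompl) :
      IsLocalization.mk' (Localization.AtPrime p) x y = 0 ↔ ∃ s ∉ p, s * x = 0 := by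
    rw [IsLocalization.mk'_eq_zero_iff]
    exact ⟨fun ⟨s, hs⟩ ↦ ⟨s, s.2, hs⟩, fun ⟨s, hs, h⟩ ↦ ⟨⟨s, hs⟩, h⟩⟩
  have hA (x : A) : algebraMap A (Localization.Away f) x = 0 → ∃ n : ℕ, f ^ n * x = 0 := by
    intro hx
    obtain ⟨⟨_, n, rfl⟩, h⟩ := (IsLocalization.map_eq_zero_iff (.powers f) _ x).mp hx
    exact ⟨n, h⟩
  have : NoZeroDivisors (Localization.AtPrime p) := by
    refine ⟨fun {x y} hxy ↦ ?_⟩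
    obtain ⟨a, s, rfl⟩ := IsLocalization.exists_mk'_eq p.primeCompl x
    obtain ⟨b, t, rfl⟩ := IsLocalization.exists_mk'_eq p.primeCompl y
    rw [← IsLocalization.mk'_mul, hmk] at hxy
    obtain ⟨u, hu, h⟩ := hxy
    rw [hmk, hmk]
    obtain ⟨e, h1, h2⟩ := exists_mul_eq_zero_of_etale (P := MvPolynomial (Fin n) k)
      (a := algebraMap A (Localization.Away f) (u * a))
      (b := algebraMap A (Localization.Away f) b) (by rw [← map_mul, mul_assoc, h, map_zero])
    obtain ⟨e', ⟨_, m, rfl⟩, rfl⟩ := IsLocalization.exists_mk'_eq (.powers f) e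
    have hspec := IsLocalization.mk'_spec (M := .powers f) (Localization.Away f) e' ⟨f ^ m, ⟨m, rfl⟩⟩
    obtain ⟨i, hi⟩ := hA (e' * b) (by
      rw [map_mul, ← hspec, mul_right_comm, h1, zero_mul])
    obtain ⟨j, hj⟩ := hA ((f ^ m - e') * (u * a)) (by
      rw [map_mul, map_sub, ← hspec]
      linear_combination (algebraMap A (Localization.Away f) (f ^ m)) * h2)
    have hfp (n : ℕ) : f ^ n ∉ p := fun h ↦ hf (‹p.IsPrime›.mem_of_pow_mem _ h)
    -- `e'` and `f ^ m - e'` sum to `f ^ m ∉ p`, so one of them lies outside `p`. Up to powers of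
    -- `f`, the first kills `b` and the second kills `u * a`.
    by_cases he : e' ∈ p
    · left
      refine ⟨f ^ j * ((f ^ m - e') * u), ?_, by linear_combination hj⟩
      refine p.primeCompl.mul_mem (hfp j) (p.primeCompl.mul_mem (fun h ↦ hfp m ?_) hu)
      exact (sub_add_cancel (f ^ m) e') ▸ p.add_mem h he
    · right
      exact ⟨f ^ i * e', p.primeCompl.mul_mem (hfp i) he, by linear_combination hi⟩
  exact NoZeroDivisors.to_isDomain _

end CommutativeAlgebra

/-- The local rings of a smooth scheme over a field are domains. -/
lemma isDomain_stalk_of_smooth {k : Type u} [Field k] {T : Scheme.{u}} (f : T ⟶ Spec (.of k))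
    [Smooth f] (x : T) : IsDomain (T.presheaf.stalk x) := by
  obtain ⟨_, ⟨V, hV, rfl⟩, hxV, -⟩ :=
    T.isBasis_affineOpens.exists_subset_of_mem_open (Set.mem_univ x) isOpen_univ
  have hs := (Smooth.smooth_appLE f (isAffineOpen_top _) hV le_top)
  have hs' : (((Scheme.ΓSpecIso (.of k)).inv ≫ f.appLE ⊤ V le_top)).hom.Smooth := by
    rw [CommRingCat.hom_comp]
    exact RingHom.Smooth.respectsIso.2 _ (Scheme.ΓSpecIso (.of k)).symm.commRingCatIsoToRingEquiv hs
  algebraize [((Scheme.ΓSpecIso (.of k)).inv ≫ f.appLE ⊤ V le_top).hom]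
  have : Algebra.Smooth k Γ(T, V) := hs'
  have := isDomain_localization_atPrime_of_smooth (k := k) (hV.primeIdealOf ⟨x, hxV⟩).asIdeal
  let := TopCat.Presheaf.algebra_section_stalk T.presheaf ⟨x, hxV⟩
  have := hV.isLocalization_stalk ⟨x, hxV⟩
  exact (IsLocalization.algEquiv (hV.primeIdealOf ⟨x, hxV⟩).asIdeal.primeCompl
    (T.presheaf.stalk x) (Localization.AtPrime (hV.primeIdealOf ⟨x, hxV⟩).asIdeal)).toMulEquiv.isDomain _

/-! ### Irreducible components of closed subsets -/

section Components

variable {T : Type u} [TopologicalSpace T]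

lemma LogPair.isIrreducible_of_mem_components {C Z : Closeds T} (hZ : Z ∈ components C) :
    IsIrreducible (Z : Set T) := (Maximal.prop (Set.mem_ofPred.mp hZ)).1

lemma LogPair.le_of_mem_components {C Z : Closeds T} (hZ : Z ∈ components C) : Z ≤ C :=
  (Maximal.prop (Set.mem_ofPred.mp hZ)).2

/-- Every irreducible subset of a closed set is contained in a component. -/
lemma LogPair.exists_mem_components {C : Closeds T} {S : Set T} (hS : IsIrreducible S)
    (hSC : S ⊆ C) : ∃ Z ∈ components C, S ⊆ Z := by
  obtain ⟨Z, hSZ, hZ⟩ := zorn_subset_nonempty {Z : Set T | IsIrreducible Z ∧ Z ⊆ C}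
    (fun c hc hc' ⟨s, hs⟩ ↦ by
      refine ⟨⋃₀ c, ⟨⟨(hc hs).1.nonempty.mono (Set.subset_sUnion_of_mem hs), ?_⟩,
        Set.sUnion_subset fun z hz ↦ (hc hz).2⟩, fun _ ↦ Set.subset_sUnion_of_mem⟩
      rintro u v hu hv ⟨y, ⟨a, ha, hya⟩, hyu⟩ ⟨x, ⟨b, hb, hxb⟩, hxv⟩
      rcases hc'.total ha hb with h | h
      · obtain ⟨z, hz, hz'⟩ := (hc hb).1.2 u v hu hv ⟨y, h hya, hyu⟩ ⟨x, hxb, hxv⟩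
        exact ⟨z, ⟨b, hb, hz⟩, hz'⟩
      · obtain ⟨z, hz, hz'⟩ := (hc ha).1.2 u v hu hv ⟨y, hya, hyu⟩ ⟨x, h hxb, hxv⟩
        exact ⟨z, ⟨a, ha, hz⟩, hz'⟩) S ⟨hS, hSC⟩
  have hcl : IsClosed Z := by
    have : closure Z ⊆ Z :=
      hZ.2 ⟨hZ.1.1.closure, C.isClosed.closure_subset_iff.mpr hZ.1.2⟩ subset_closure
    exact closure_subset_iff_isClosed.mp this
  exact ⟨⟨Z, hcl⟩, ⟨hZ.1, fun Y hY h ↦ hZ.2 hY h⟩, hSZ⟩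

/-- A closed subset of a noetherian space has finitely many components. -/
lemma LogPair.finite_components [NoetherianSpace T] (C : Closeds T) : (components C).Finite := by
  obtain ⟨S, hS, hirr, rfl⟩ := NoetherianSpace.exists_finite_set_closeds_irreducible C
  refine hS.subset fun Z hZ ↦ ?_
  have hsub : (Z : Set T) ⊆ ⋃₀ ((↑) '' S) := by
    refine (SetLike.coe_subset_coe.mpr (le_of_mem_components hZ)).trans ?_
    lift S to Finset (Closeds T) using hS
    simp [← Finset.sup_id_eq_sSup, Closeds.coe_finset_sup]
  obtain ⟨_, ⟨s, hs, rfl⟩, hZs⟩ := (isIrreducible_iff_sUnion_isClosed.mp (isIrreducible_of_mem_components hZ))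
    (hS.image _).toFinset (by simpa using fun s _ ↦ s.isClosed) (by simpa using hsub) |>.imp
      fun t ht ↦ (by simpa using ht : t ∈ ((↑) '' S : Set (Set T)) ∧ _)
  have hle : Z ≤ s := hZs
  rwa [hle.antisymm (hZ.2 ⟨hirr s hs, le_sSup hs⟩ hle)]

/-- If the generizations of a point of a closed set `C` of a sober space form an irreducible
subset, the point lies in only one component of `C`. -/
lemma LogPair.components_eq_of_mem [QuasiSober T] {C Z Z' : Closeds T} {x : T}
    (hx : IsIrreducible {y : T | y ∈ C ∧ y ⤳ x}) (hZ : Z ∈ components C) (hZ' : Z' ∈ components C)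
    (hxZ : x ∈ Z) (hxZ' : x ∈ Z') : Z = Z' := by
  -- The generic point of a component through `x` is itself a generization of `x` in `C`; by
  -- maximality the component is the closure of all such generizations, hence determined by `x`.
  have key (W : Closeds T) (hW : W ∈ components C) (hxW : x ∈ W) :
      (W : Set T) = closure {y : T | y ∈ C ∧ y ⤳ x} := by
    have hgen := (isIrreducible_of_mem_components hW).isGenericPoint_genericPoint W.isClosed
    have h1 : (W : Set T) ⊆ closure {y : T | y ∈ C ∧ y ⤳ x} := by
      rw [← hgen.def]
      refine closure_mono (Set.singleton_subset_iff.mpr ⟨le_of_mem_components hW hgen.mem, ?_⟩)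
      exact hgen.specializes hxW
    exact h1.antisymm (hW.2 (y := ⟨_, isClosed_closure⟩) ⟨hx.closure,
      closure_minimal (fun y hy ↦ hy.1) C.isClosed⟩ h1)
  exact SetLike.coe_injective ((key Z hZ hxZ).trans (key Z' hZ' hxZ').symm)

/-- If the generizations of each point of a closed set `C` of a noetherian sober space form an
irreducible subset, the components of `C` are open in `C`. -/
lemma LogPair.isClosed_diff_of_mem_components [NoetherianSpace T] [QuasiSober T] {C Z : Closeds T}
    (hC : ∀ x ∈ C, IsIrreducible {y : T | y ∈ C ∧ y ⤳ x}) (hZ : Z ∈ components C) :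
    IsClosed ((C : Set T) \ Z) := by
  have : (C : Set T) \ Z = ⋃ W ∈ components C \ {Z}, (W : Set T) := by
    ext x
    simp only [Set.mem_sdiff, SetLike.mem_coe, Set.mem_singleton_iff, Set.mem_iUnion, exists_prop]
    constructor
    · rintro ⟨hx, hxZ⟩
      obtain ⟨W, hW, hxW⟩ := exists_mem_components (C := C) (S := {x}) isIrreducible_singleton
        (Set.singleton_subset_iff.mpr hx)
      rw [Set.singleton_subset_iff] at hxW
      exact ⟨W, ⟨hW, fun h ↦ hxZ (h ▸ hxW)⟩, hxW⟩
    · rintro ⟨W, ⟨hW, hne⟩, hxW⟩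
      refine ⟨le_of_mem_components hW hxW, fun hxZ ↦ hne ?_⟩
      exact components_eq_of_mem (hC x (le_of_mem_components hW hxW)) hW hZ hxW hxZ
  rw [this]
  exact (finite_components C).sdiff.isClosed_biUnion fun W _ ↦ W.isClosed

end Components

/-- The generizations of a point whose local ring is a domain form an irreducible set. -/
lemma AlgebraicGeometry.Scheme.isIrreducible_generizations {T : Scheme.{u}} (t : T)
    [IsDomain (T.presheaf.stalk t)] : IsIrreducible {y : T | y ⤳ t} := by
  rw [← Scheme.range_fromSpecStalk, ← Set.image_univ]
  exact (IrreducibleSpace.isIrreducible_univ _).image _ (T.fromSpecStalk t).continuous.continuousOn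

/-! ### Strata of the divisor and their base changes -/

section Strata

variable {K : Type u} [Field K] {X : Scheme.{u}} (f : X ⟶ Spec (.of K))

lemma LogPair.support_stratumIdeal (A : Set (Closeds X)) :
    (stratumIdeal A).support = stratum A := by
  have h (Z : Closeds X) : (Scheme.IdealSheafData.vanishingIdeal Z).support = Z :=
    SetLike.coe_injective (by simp)
  simp [stratumIdeal, stratum, sInf_eq_iInf, h]

/-- The base change of a smooth stratum is locally irreducible. -/
lemma LogPair.isIrreducible_generizations_of_smooth (L : Type u) [Field L] [Algebra K L]
    (A : Set (Closeds X)) [Smooth ((stratumIdeal A).subschemeι ≫ f)]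
    (x : baseChange f L) (hx : x ∈ closedBaseChange f L (stratum A)) :
    IsIrreducible {y : baseChange f L | y ∈ closedBaseChange f L (stratum A) ∧ y ⤳ x} := by
  let i := (stratumIdeal A).subschemeι
  -- `j` is the closed immersion of the base-changed stratum. Its source is smooth over `L`, so
  -- generizations can be computed there, in local rings that are domains.
  let j := pullback.snd i (pullback.fst f (specMap K L))
  have hrange : Set.range j = (closedBaseChange f L (stratum A) : Set (baseChange f L)) := by
    rw [Scheme.Pullback.range_snd, Scheme.IdealSheafData.range_subschemeι, support_stratumIdeal]
    rfl
  have hsm : Smooth (j ≫ pullback.snd f (specMap K L)) := by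
    rw [← pullbackRightPullbackFstIso_hom_snd]
    infer_instance
  obtain ⟨t, rfl⟩ : x ∈ Set.range j := hrange ▸ hx
  have := isDomain_stalk_of_smooth (j ≫ pullback.snd f (specMap K L)) t
  convert (Scheme.isIrreducible_generizations t).image j j.continuous.continuousOn using 1
  ext y
  constructor
  · rintro ⟨hy, hyt⟩
    obtain ⟨s, rfl⟩ : y ∈ Set.range j := hrange ▸ hy
    exact ⟨s, j.isClosedEmbedding.isInducing.specializes_iff.mp hyt, rfl⟩
  · rintro ⟨s, hs, rfl⟩
    exact ⟨by rw [← SetLike.mem_coe, ← hrange]; exact Set.mem_range_self s, Specializes.map hs j.continuous⟩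

end Strata

/-- The unique point of the spectrum of a field. -/
noncomputable def LogPair.specPoint (F : Type u) [Field F] : Spec (.of F) :=
  IsLocalRing.closedPoint F

lemma LogPair.eq_specPoint {F : Type u} [Field F] (y : Spec (.of F)) : y = specPoint F :=
  Subsingleton.elim (α := PrimeSpectrum F) y _

/-! ### Topology of the projections between base changes -/

section BaseChange

variable {K : Type u} [Field K] {X : Scheme.{u}} (f : X ⟶ Spec (.of K))

lemma LogPair.baseChangeMap_fst {L Ω : Type u} [Field L] [Algebra K L]
    [Field Ω] [Algebra K Ω] (σ : L →ₐ[K] Ω) :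
    baseChangeMap f σ ≫ pullback.fst f (specMap K L) = pullback.fst f (specMap K Ω) :=
  (pullback.lift_fst _ _ _).trans (Category.comp_id _)

lemma LogPair.baseChangeMap_snd {L Ω : Type u} [Field L] [Algebra K L]
    [Field Ω] [Algebra K Ω] (σ : L →ₐ[K] Ω) :
    baseChangeMap f σ ≫ pullback.snd f (specMap K L) =
      pullback.snd f (specMap K Ω) ≫ Spec.map (CommRingCat.ofHom σ.toRingHom) :=
  pullback.lift_snd _ _ _

lemma LogPair.isPullback_baseChangeMap {L Ω : Type u} [Field L] [Algebra K L]
    [Field Ω] [Algebra K Ω] (σ : L →ₐ[K] Ω) :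
    IsPullback (baseChangeMap f σ) (pullback.snd f (specMap K Ω)) (pullback.snd f (specMap K L))
      (Spec.map (CommRingCat.ofHom σ.toRingHom)) := by
  refine IsPullback.of_right (h₁₂ := pullback.fst f (specMap K L)) (v₁₃ := f)
    (h₂₂ := specMap K L) ?_ (baseChangeMap_snd f σ) (IsPullback.of_hasPullback _ _)
  have h : Spec.map (CommRingCat.ofHom σ.toRingHom) ≫ specMap K L = specMap K Ω := by
    rw [← Spec.map_comp, ← CommRingCat.ofHom_comp]
    exact congrArg (fun φ ↦ Spec.map (CommRingCat.ofHom φ)) σ.comp_algebraMap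
  rw [baseChangeMap_fst, h]
  exact IsPullback.of_hasPullback _ _

lemma LogPair.preimage_baseChangeMap_closedBaseChange {L Ω : Type u} [Field L] [Algebra K L]
    [Field Ω] [Algebra K Ω] (σ : L →ₐ[K] Ω) (C : Closeds X) :
    (closedBaseChange f L C).preimage (baseChangeMap f σ).continuous = closedBaseChange f Ω C := by
  ext x
  change pullback.fst f (specMap K L) (baseChangeMap f σ x) ∈ C ↔
    pullback.fst f (specMap K Ω) x ∈ C
  rw [← Scheme.Hom.comp_apply, baseChangeMap_fst]

/-- Morphisms to the spectrum of a field are universally open, and this projection is a base change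
of one. -/
lemma LogPair.isOpenMap_baseChangeMap {L Ω : Type u} [Field L] [Algebra K L]
    [Field Ω] [Algebra K Ω] (σ : L →ₐ[K] Ω) : IsOpenMap (baseChangeMap f σ) := by
  have : Subsingleton (Spec (.of L)) := inferInstanceAs (Subsingleton (PrimeSpectrum L))
  have : UniversallyOpen (baseChangeMap f σ) :=
    MorphismProperty.of_isPullback (isPullback_baseChangeMap f σ).flip inferInstance
  exact (baseChangeMap f σ).isOpenMap

/-- For an algebraic extension the projection is a base change of an integral morphism. -/
lemma LogPair.isClosedMap_baseChangeMap {L Ω : Type u} [Field L] [Algebra K L]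
    [Field Ω] [Algebra K Ω] [Algebra L Ω] [IsScalarTower K L Ω] [Algebra.IsAlgebraic L Ω] :
    IsClosedMap (baseChangeMap f (IsScalarTower.toAlgHom K L Ω)) := by
  have : IsIntegralHom
      (Spec.map (CommRingCat.ofHom (IsScalarTower.toAlgHom K L Ω).toRingHom)) := by
    rw [IsIntegralHom.SpecMap_iff]
    exact algebraMap_isIntegral_iff.mpr (inferInstanceAs (Algebra.IsIntegral L Ω))
  have : IsIntegralHom (baseChangeMap f (IsScalarTower.toAlgHom K L Ω)) :=
    MorphismProperty.of_isPullback (isPullback_baseChangeMap f _).flip this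
  exact (baseChangeMap f (IsScalarTower.toAlgHom K L Ω)).isClosedMap

/-- The fibre of `X_Ω ⟶ X_L` over an `L`-rational point is a single point. -/
lemma LogPair.eq_of_baseChangeMap_eq {L Ω : Type u} [Field L] [Algebra K L]
    [Field Ω] [Algebra K Ω] (σ : L →ₐ[K] Ω) (φ : Spec (.of L) ⟶ baseChange f L)
    (hφ : φ ≫ pullback.snd f (specMap K L) = 𝟙 _) {a b : baseChange f Ω}
    (ha : baseChangeMap f σ a ∈ Set.range φ) (hb : baseChangeMap f σ b ∈ Set.range φ) :
    a = b := by
  have h := (isPullback_baseChangeMap f σ)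
  let g := Spec.map (CommRingCat.ofHom σ.toRingHom)
  let s : Spec (.of Ω) ⟶ baseChange f Ω := h.lift (g ≫ φ) (𝟙 _)
    (by rw [Category.assoc, hφ, Category.comp_id, Category.id_comp])
  -- The fibre over the section `φ` is the pullback of `φ`, namely `Spec Ω`, which has one point.
  have hs : IsPullback s g (baseChangeMap f σ) φ := by
    refine IsPullback.of_right (h₁₂ := pullback.snd f (specMap K Ω))
      (h₂₂ := pullback.snd f (specMap K L)) (v₁₃ := g) ?_ (h.lift_fst _ _ _) h.flip
    rw [hφ, h.lift_snd]
    exact .of_horiz_isIso ⟨by simp⟩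
  have hrange {c : baseChange f Ω} (hc : baseChangeMap f σ c ∈ Set.range φ) : c ∈ Set.range s := by
    obtain ⟨t, ht⟩ := hc
    obtain ⟨z, hz, -⟩ := Scheme.exists_preimage_of_isPullback hs c t ht.symm
    exact ⟨z, hz⟩
  obtain ⟨x, rfl⟩ := hrange ha
  obtain ⟨y, rfl⟩ := hrange hb
  rw [eq_specPoint x, eq_specPoint y]

end BaseChange

/-! ### Rational points on strata and faces of the analytic Clemens complex -/

section Faces

variable {K : Type u} [Field K] {X : Scheme.{u}} {f : X ⟶ Spec (.of K)}

/-- The point of `X_L` defined by an `L`-point of `X`. -/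
noncomputable def LogPair.Pt.sectionHom {L : Type u} [Field L] [Algebra K L] (x : Pt f L) :
    Spec (.of L) ⟶ baseChange f L :=
  pullback.lift x.hom (𝟙 _) (by rw [x.comp_eq, Category.id_comp])

lemma LogPair.Pt.sectionHom_snd {L : Type u} [Field L] [Algebra K L] (x : Pt f L) :
    x.sectionHom ≫ pullback.snd f (specMap K L) = 𝟙 _ := pullback.lift_snd _ _ _

lemma LogPair.Pt.sectionHom_fst {L : Type u} [Field L] [Algebra K L] (x : Pt f L) :
    x.sectionHom ≫ pullback.fst f (specMap K L) = x.hom := pullback.lift_fst _ _ _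

variable {L : Type u} [Field L] [Algebra K L] {Kbar : Type u} [Field Kbar] [Algebra K Kbar]
  (σ : Kbar →ₐ[K] AlgebraicClosure L)

/-- The point of `X_Ω` defined by an `L`-point of `X`, for `Ω` the algebraic closure of `L`. -/
noncomputable def LogPair.Pt.closureSection (x : Pt f L) :
    Spec (.of (AlgebraicClosure L)) ⟶ baseChange f (AlgebraicClosure L) :=
  pullback.lift (specMap L (AlgebraicClosure L) ≫ x.hom) (𝟙 _) (by
    rw [Category.assoc, x.comp_eq, ← Spec.map_comp, ← CommRingCat.ofHom_comp, Category.id_comp,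
      ← IsScalarTower.algebraMap_eq])

lemma LogPair.Pt.closureSection_baseChangeMap (x : Pt f L) :
    x.closureSection ≫ baseChangeMap f σ = x.geom σ := by
  apply pullback.hom_ext
  · rw [Category.assoc, baseChangeMap_fst, closureSection, Pt.geom, pullback.lift_fst,
      pullback.lift_fst]
  · rw [Category.assoc, baseChangeMap_snd, closureSection, Pt.geom, pullback.lift_snd_assoc,
      pullback.lift_snd, Category.id_comp]

lemma LogPair.Pt.closureSection_toAlgHom (x : Pt f L) :
    x.closureSection ≫ baseChangeMap f (IsScalarTower.toAlgHom K L (AlgebraicClosure L)) =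
      specMap L (AlgebraicClosure L) ≫ x.sectionHom := by
  apply pullback.hom_ext
  · rw [Category.assoc, baseChangeMap_fst, closureSection, pullback.lift_fst, Category.assoc,
      Pt.sectionHom_fst]
  · simp only [closureSection, Category.assoc, baseChangeMap_snd, Pt.sectionHom_snd,
      Category.comp_id, pullback.lift_snd_assoc, Category.id_comp]
    rfl

/-- The component of the geometric stratum through a rational point is defined over the field of
definition of the point. -/
lemma LogPair.definedOver_of_mem [LocallyOfFiniteType f] [CompactSpace X] [IsAlgClosed Kbar]
    (A : Set (Closeds X)) [Smooth ((stratumIdeal A).subschemeι ≫ f)] (x : Pt f L)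
    {Z : Closeds (baseChange f Kbar)} (hZ : Z ∈ components (closedBaseChange f Kbar (stratum A)))
    (hx : x ∈ ratPts σ Z) : DefinedOver σ Z := by
  let Ω := AlgebraicClosure L
  have hN (F : Type u) [Field F] [Algebra K F] : NoetherianSpace (baseChange f F) := by
    have : IsLocallyNoetherian (baseChange f F) :=
      LocallyOfFiniteType.isLocallyNoetherian (pullback.snd f (specMap K F))
    have : QuasiCompact f := inferInstance
    have : CompactSpace (baseChange f F) :=
      QuasiCompact.compactSpace_of_compactSpace (pullback.snd f (specMap K F))
    have : AlgebraicGeometry.IsNoetherian (baseChange f F) := {}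
    infer_instance
  have := hN Kbar
  have := hN L
  let τ := IsScalarTower.toAlgHom K L Ω
  let p := baseChangeMap f σ
  let q := baseChangeMap f τ
  let e : baseChange f Ω := x.closureSection (specPoint Ω)
  have hp : p e ∈ Z := by
    apply hx
    rw [← Pt.closureSection_baseChangeMap]
    exact ⟨specPoint Ω, Scheme.Hom.comp_apply _ _ _⟩
  have hq : q e ∈ Set.range x.sectionHom := by
    refine ⟨specMap L Ω (specPoint Ω), ?_⟩
    rw [← Scheme.Hom.comp_apply, ← Pt.closureSection_toAlgHom, Scheme.Hom.comp_apply]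
  have hCp := preimage_baseChangeMap_closedBaseChange f σ (stratum A)
  have hCq := preimage_baseChangeMap_closedBaseChange f τ (stratum A)
  have hCpq (y : baseChange f Ω) : p y ∈ closedBaseChange f Kbar (stratum A) ↔
      q y ∈ closedBaseChange f L (stratum A) :=
    SetLike.ext_iff.mp (hCp.trans hCq.symm) y
  have hqe : q e ∈ closedBaseChange f L (stratum A) :=
    (hCpq e).mp (le_of_mem_components hZ hp)
  obtain ⟨Y, hY, heY⟩ := exists_mem_components (C := closedBaseChange f L (stratum A))
    (S := {q e}) isIrreducible_singleton (Set.singleton_subset_iff.mpr hqe)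
  rw [Set.singleton_subset_iff] at heY
  have hZcl := isClosed_diff_of_mem_components
    (isIrreducible_generizations_of_smooth f Kbar A) hZ
  have hYcl := isClosed_diff_of_mem_components
    (isIrreducible_generizations_of_smooth f L A) hY
  -- Otherwise the open sets `p '' O₁` and `p '' O₂` both meet the irreducible `Z`, hence share a
  -- closed point of `Z`. It is `Kbar`-rational, so only one point of `X_Ω` lies above it, yet `O₁`
  -- and `O₂` are disjoint above the stratum.
  have hsub : ∀ s, p s ∈ Z → q s ∈ Y := by
    by_contra! h
    obtain ⟨s, hsZ, hsY⟩ := h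
    let O₁ : Set (baseChange f Ω) := q ⁻¹' (closedBaseChange f L (stratum A) \ Y)ᶜ
    let O₂ : Set (baseChange f Ω) := q ⁻¹' (Y : Set (baseChange f L))ᶜ
    have hO₁ : IsOpen (p '' O₁) :=
      isOpenMap_baseChangeMap f σ _ (hYcl.isOpen_compl.preimage q.continuous)
    have hO₂ : IsOpen (p '' O₂) :=
      isOpenMap_baseChangeMap f σ _ (Y.isClosed.isOpen_compl.preimage q.continuous)
    obtain ⟨z, hz⟩ := (isIrreducible_of_mem_components hZ).2 _ _ hO₁ hO₂
      ⟨p e, hp, e, fun h ↦ h.2 heY, rfl⟩ ⟨p s, hsZ, s, hsY, rfl⟩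
    have : JacobsonSpace (baseChange f Kbar) :=
      LocallyOfFiniteType.jacobsonSpace (pullback.snd f (specMap K Kbar))
    obtain ⟨z, ⟨hzZ, ⟨a, ha, haz⟩, ⟨b, hb, hbz⟩⟩, hz⟩ :=
      nonempty_inter_closedPoints ⟨z, hz⟩ (Z.isClosed.isLocallyClosed.inter
        (hO₁.inter hO₂).isLocallyClosed)
    have hzr : z ∈ Set.range (pointOfClosedPoint (pullback.snd f (specMap K Kbar)) z hz) :=
      ⟨specPoint _, pointOfClosedPoint_apply ..⟩
    have hab : a = b := eq_of_baseChangeMap_eq f σ _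
      (pointOfClosedPoint_comp (pullback.snd f (specMap K Kbar)) z hz)
      (by change p a ∈ _; rwa [haz]) (by change p b ∈ _; rwa [hbz])
    subst hab
    exact ha ⟨(hCpq a).mp (le_of_mem_components hZ (haz ▸ hzZ)), hb⟩
  -- Otherwise a dense part of `Y`, and then all of `Y`, lies in the closed set `q '' F`. The point
  -- `q e` is `L`-rational, so `e` is the only point above it and would lie in `F`, although `p e ∈
  -- Z`.
  have hsup : ∀ s, q s ∈ Y → p s ∈ Z := by
    by_contra! h
    obtain ⟨s, hsY, hsZ⟩ := h
    let O : Set (baseChange f Ω) := p ⁻¹' (Z : Set (baseChange f Kbar))ᶜ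
    let F : Set (baseChange f Ω) := p ⁻¹' (closedBaseChange f Kbar (stratum A) \ Z)
    have hO : IsOpen (q '' O) :=
      isOpenMap_baseChangeMap f τ _ (Z.isClosed.isOpen_compl.preimage p.continuous)
    have hF : IsClosed (q '' F) :=
      isClosedMap_baseChangeMap f _ (hZcl.preimage p.continuous)
    have hOF : (Y : Set (baseChange f L)) ∩ q '' O ⊆ q '' F := by
      rintro _ ⟨hy, a, ha, rfl⟩
      exact ⟨a, ⟨(hCpq a).mpr (le_of_mem_components hY hy), ha⟩, rfl⟩
    have hYF : (Y : Set (baseChange f L)) ⊆ q '' F :=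
      (subset_closure_inter_of_isPreirreducible_of_isOpen
        (isIrreducible_of_mem_components hY).2 hO ⟨q s, hsY, s, hsZ, rfl⟩).trans
        (closure_minimal hOF hF)
    obtain ⟨a, ha, hae⟩ := hYF heY
    have : a = e := eq_of_baseChangeMap_eq f τ x.sectionHom x.sectionHom_snd
      (by change q a ∈ _; rwa [hae]) hq
    exact ha.2 (this ▸ hp)
  exact ⟨Y, SetLike.ext fun s ↦ ⟨hsub s, hsup s⟩⟩

lemma LogPair.mem_ratPts_iff {x : Pt f L} {Z : Closeds (baseChange f Kbar)} :
    x ∈ ratPts σ Z ↔ x.geom σ (specPoint (AlgebraicClosure L)) ∈ Z := by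
  refine ⟨fun h ↦ h ⟨_, rfl⟩, ?_⟩
  rintro h _ ⟨y, rfl⟩
  rwa [eq_specPoint y]

lemma LogPair.geom_mem_closedBaseChange_iff {x : Pt f L} {C : Closeds X} :
    x.geom σ (specPoint (AlgebraicClosure L)) ∈ closedBaseChange f Kbar C ↔
      x.hom (specPoint L) ∈ C := by
  change pullback.fst f (specMap K Kbar) _ ∈ C ↔ _
  rw [← Scheme.Hom.comp_apply, Pt.geom, pullback.lift_fst, Scheme.Hom.comp_apply]
  rw [eq_specPoint (specMap L (AlgebraicClosure L) _)]

/-- A rational point of the stratum of a face that lies on a further component of the divisor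
lies on the stratum of a larger face. -/
lemma LogPair.exists_lt_mem_ratPts [LocallyOfFiniteType f] [CompactSpace X] [IsAlgClosed Kbar]
    {D : Closeds X} (hD : IsSNCDivisor f D) (A : AnFace f D σ) (x : Pt f L)
    (hx : x ∈ ratPts σ A.1.carrier) {β : Closeds X} (hβ : β ∈ components D) (hβA : β ∉ A.1.verts)
    (hxβ : x.hom (specPoint L) ∈ β) :
    ∃ B : AnFace f D σ, A < B ∧ x ∈ ratPts σ B.1.carrier := by
  have hsub : insert β A.1.verts ⊆ components D := Set.insert_subset hβ A.1.verts_subset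
  have hle : stratum (insert β A.1.verts) ≤ stratum A.1.verts :=
    sInf_le_sInf (Set.subset_insert _ _)
  have hle' : closedBaseChange f Kbar (stratum (insert β A.1.verts)) ≤
      closedBaseChange f Kbar (stratum A.1.verts) := fun y hy ↦ hle hy
  have hxA := (mem_ratPts_iff σ).mp hx
  have hxS : x.hom (specPoint L) ∈ stratum A.1.verts :=
    (geom_mem_closedBaseChange_iff σ).mp (le_of_mem_components A.1.carrier_mem hxA)
  have hxS' : x.hom (specPoint L) ∈ stratum (insert β A.1.verts) := by
    rw [stratum, sInf_insert]
    exact ⟨hxβ, hxS⟩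
  have := (hD _ hsub).1
  have := (hD _ A.1.verts_subset).1
  obtain ⟨Z, hZ, hxZ⟩ := exists_mem_components
    (C := closedBaseChange f Kbar (stratum (insert β A.1.verts))) isIrreducible_singleton
    (Set.singleton_subset_iff.mpr ((geom_mem_closedBaseChange_iff σ).mpr hxS'))
  rw [Set.singleton_subset_iff] at hxZ
  have hxr : x ∈ ratPts σ Z := (mem_ratPts_iff σ).mpr hxZ
  -- Only one component of the smaller face's stratum passes through `x`, so the component
  -- containing `Z` must be `A.1.carrier`.
  have hZA : Z ≤ A.1.carrier := by
    obtain ⟨Z', hZ', hZZ'⟩ := exists_mem_components (isIrreducible_of_mem_components hZ)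
      ((le_of_mem_components hZ).trans hle')
    rwa [components_eq_of_mem (isIrreducible_generizations_of_smooth f Kbar _ _ (hle'
      (le_of_mem_components hZ hxZ))) A.1.carrier_mem hZ' hxA (hZZ' hxZ)]
  refine ⟨⟨⟨_, Z, hsub, hZ⟩, definedOver_of_mem σ _ x hZ hxr, ⟨x, hxr⟩⟩, ?_, hxr⟩
  refine lt_of_le_not_ge ⟨Set.subset_insert _ _, hZA⟩ fun h ↦ hβA (h.1 (Set.mem_insert _ _))

end Faces

/-! ### Generators of a pushout of rings -/

section Pushout

/-- The two coprojections of a pushout of commutative rings generate it. -/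
lemma CommRingCat.closure_range_union_range_of_isPushout {R A B P : CommRingCat.{u}} {a : R ⟶ A}
    {b : R ⟶ B} {i : A ⟶ P} {j : B ⟶ P} (h : IsPushout a b i j) :
    Subring.closure (Set.range i ∪ Set.range j) = ⊤ := by
  let S := Subring.closure (Set.range i ∪ Set.range j)
  let i' : A ⟶ CommRingCat.of S := CommRingCat.ofHom
    (i.hom.codRestrict S fun x ↦ Subring.subset_closure (.inl ⟨x, rfl⟩))
  let j' : B ⟶ CommRingCat.of S := CommRingCat.ofHom
    (j.hom.codRestrict S fun x ↦ Subring.subset_closure (.inr ⟨x, rfl⟩))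
  have hi : i' ≫ CommRingCat.ofHom S.subtype = i := rfl
  have hj : j' ≫ CommRingCat.ofHom S.subtype = j := rfl
  have w : a ≫ i' = b ≫ j' := by
    refine CommRingCat.hom_ext (RingHom.ext fun x ↦ Subtype.ext ?_)
    exact (DFunLike.congr_fun (congrArg CommRingCat.Hom.hom h.w) x)
  -- The universal property gives a section of the inclusion of the generated subring, so the
  -- inclusion is surjective.
  have hd : h.desc i' j' w ≫ CommRingCat.ofHom S.subtype = 𝟙 P := by
    apply h.hom_ext
    · rw [h.inl_desc_assoc, hi, Category.comp_id]
    · rw [h.inr_desc_assoc, hj, Category.comp_id]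
  rw [eq_top_iff]
  intro x _
  have hx : ((h.desc i' j' w).hom x : P) = x :=
    DFunLike.congr_fun (congrArg CommRingCat.Hom.hom hd) x
  exact hx ▸ ((h.desc i' j' w).hom x).2

end Pushout

/-! ### Values of regular functions at field-valued points -/

section Evaluation

variable {X Y : Scheme.{u}} {L : Type u} [Field L]

/-- Evaluation of regular functions at a field-valued point, as a ring homomorphism. -/
noncomputable def LogPair.evalHom (x : Spec (.of L) ⟶ X) (U : X.Opens) (hx : ⊤ ≤ x ⁻¹ᵁ U) :
    Γ(X, U) →+* L :=
  (x.appLE U ⊤ hx ≫ (Scheme.ΓSpecIso (.of L)).hom).hom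

lemma LogPair.top_le_preimage_iff {x : Spec (.of L) ⟶ X} {U : X.Opens} :
    ⊤ ≤ x ⁻¹ᵁ U ↔ x (specPoint L) ∈ U :=
  ⟨fun h ↦ h (Set.mem_univ (specPoint L)), fun h y _ ↦ by
    rw [eq_specPoint y]; exact h⟩

lemma LogPair.evalHom_congr {x y : Spec (.of L) ⟶ X} (h : x = y) {U : X.Opens}
    (hx : ⊤ ≤ x ⁻¹ᵁ U) (hy : ⊤ ≤ y ⁻¹ᵁ U) (s : Γ(X, U)) : evalHom x U hx s = evalHom y U hy s := by
  subst h
  rfl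

lemma LogPair.evalHom_map (x : Spec (.of L) ⟶ X) {U V : X.Opens} (hVU : V ≤ U)
    (hx : ⊤ ≤ x ⁻¹ᵁ V) (h : Γ(X, U)) :
    evalHom x V hx (X.presheaf.map (homOfLE hVU).op h) = evalHom x U (hx.trans
      (x.preimage_mono hVU)) h := by
  have := Scheme.Hom.map_appLE_assoc x hx (homOfLE hVU).op (Scheme.ΓSpecIso (.of L)).hom
  exact DFunLike.congr_fun (congrArg CommRingCat.Hom.hom this) h

lemma LogPair.evalHom_comp (x : Spec (.of L) ⟶ X) (g : X ⟶ Y) {U : Y.Opens} {V : X.Opens}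
    (hVU : V ≤ g ⁻¹ᵁ U) (hx : ⊤ ≤ x ⁻¹ᵁ V) (h : Γ(Y, U)) :
    evalHom (x ≫ g) U (hx.trans (x.preimage_mono hVU)) h = evalHom x V hx (g.appLE U V hVU h) := by
  have := Scheme.Hom.appLE_comp_appLE_assoc x g U V ⊤ hVU hx (Scheme.ΓSpecIso (.of L)).hom
  exact DFunLike.congr_fun (congrArg CommRingCat.Hom.hom this.symm) h

lemma LogPair.evalHom_SpecMap_comp {R : CommRingCat.{u}} (φ : R ⟶ .of L) (x : Spec R ⟶ X)
    {U : X.Opens} (hx : ⊤ ≤ x ⁻¹ᵁ U) (hx' : ⊤ ≤ (Spec.map φ ≫ x) ⁻¹ᵁ U) (h : Γ(X, U)) :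
    evalHom (Spec.map φ ≫ x) U hx' h =
      φ.hom ((Scheme.ΓSpecIso R).hom.hom ((x.appLE U ⊤ hx).hom h)) := by
  rw [evalHom_comp _ x hx le_top]
  have := Scheme.ΓSpecIso_naturality φ
  rw [Scheme.Hom.appTop, Scheme.Hom.app_eq_appLE] at this
  exact DFunLike.congr_fun (congrArg CommRingCat.Hom.hom this) (x.appLE U ⊤ hx h)

lemma LogPair.evalHom_map_comp {L' : Type u} [Field L'] (φ : L →+* L') (x : Spec (.of L) ⟶ X)
    {U : X.Opens} (hx : ⊤ ≤ x ⁻¹ᵁ U) (hx' : ⊤ ≤ (Spec.map (CommRingCat.ofHom φ) ≫ x) ⁻¹ᵁ U)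
    (h : Γ(X, U)) :
    evalHom (Spec.map (CommRingCat.ofHom φ) ≫ x) U hx' h = φ (evalHom x U hx h) :=
  evalHom_SpecMap_comp (CommRingCat.ofHom φ) x hx hx' h

lemma LogPair.mem_basicOpen_iff_evalHom_ne_zero (x : Spec (.of L) ⟶ X) {U : X.Opens}
    (hx : ⊤ ≤ x ⁻¹ᵁ U) (h : Γ(X, U)) :
    x (specPoint L) ∈ X.basicOpen h ↔ evalHom x U hx h ≠ 0 := by
  have key : x (specPoint L) ∈ X.basicOpen h ↔
      specPoint L ∈ (Spec (.of L)).basicOpen (x.appLE U ⊤ hx h) := by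
    rw [Scheme.basicOpen_appLE, top_inf_eq]
    rfl
  have heq : evalHom x U hx h = (Scheme.ΓSpecIso (.of L)).hom (x.appLE U ⊤ hx h) := rfl
  rw [key, heq]
  generalize x.appLE U ⊤ hx h = s
  constructor
  · rintro hs h0
    have : s = 0 := (Scheme.ΓSpecIso (.of L)).commRingCatIsoToRingEquiv.injective
      (h0.trans (map_zero _).symm)
    rw [this, Scheme.basicOpen_zero] at hs
    exact hs
  · intro hs
    have : IsUnit s := by
      have := (isUnit_iff_ne_zero.mpr hs).map (Scheme.ΓSpecIso (.of L)).inv.hom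
      simpa using this
    rw [Scheme.basicOpen_of_isUnit _ this]
    trivial

variable {K : Type u} [Field K] {f : X ⟶ Spec (.of K)} [Algebra K L]

lemma LogPair.evalHom_constants (x : Pt f L) {U : X.Opens} (hx : ⊤ ≤ x.hom ⁻¹ᵁ U) (c : K) :
    evalHom x.hom U hx (constants f U c) = algebraMap K L c := by
  have h1 := evalHom_comp x.hom f (U := ⊤) (V := U) le_top hx ((Scheme.ΓSpecIso (.of K)).inv c)
  rw [constants, CommRingCat.hom_comp, RingHom.comp_apply, ← h1]
  have h2 := Scheme.ΓSpecIso_naturality (CommRingCat.ofHom (algebraMap K L))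
  rw [Scheme.Hom.appTop, Scheme.Hom.app_eq_appLE] at h2
  simp only [evalHom, x.comp_eq]
  refine (ConcreteCategory.congr_hom h2 ((Scheme.ΓSpecIso (.of K)).inv c)).trans ?_
  simp

lemma LogPair.evalHom_extend (x : Pt f K) {U : X.Opens} (hx : ⊤ ≤ x.hom ⁻¹ᵁ U)
    (hx' : ⊤ ≤ (x.extend L).hom ⁻¹ᵁ U) (h : Γ(X, U)) :
    evalHom (x.extend L).hom U hx' h = algebraMap K L (evalHom x.hom U hx h) :=
  evalHom_map_comp (algebraMap K L) x.hom hx hx' h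

end Evaluation

/-! ### Compact sets in the analytic topology -/

section AnalyticTopology

variable {K : Type u} [Field K] {X : Scheme.{u}} {f : X ⟶ Spec (.of K)}

lemma LogPair.isOpen_setOf_evalHom_mem {L : Type u} [Field L] [Algebra K L] [TopologicalSpace L]
    (U : X.Opens) (h : Γ(X, U)) {O : Set L} (hO : IsOpen O) :
    IsOpen {x : Pt f L | ∃ hx : ⊤ ≤ x.hom ⁻¹ᵁ U, evalHom x.hom U hx h ∈ O} :=
  isOpen_generateFrom_of_mem ⟨U, h, O, hO, rfl⟩

lemma LogPair.isOpen_setOf_mem {L : Type u} [Field L] [Algebra K L] [TopologicalSpace L]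
    (U : X.Opens) : IsOpen {x : Pt f L | x.hom (specPoint L) ∈ U} := by
  convert isOpen_setOf_evalHom_mem (f := f) U 0 (isOpen_univ (X := L)) using 1
  ext x
  simp only [Set.mem_ofPred, Set.mem_univ, exists_prop, and_true, top_le_preimage_iff]

variable {L : Type u} [NormedField L] [Algebra K L]

/-- On an affine open subset, the evaluation at the points of a polydisc of bounded functions gives
a compact subset of the space of rational points. -/
lemma LogPair.isCompact_setOf_norm_evalHom_le [ProperSpace L] {U : X.Opens} (hU : IsAffineOpen U)
    {ι : Type*} (t : ι → Γ(X, U))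
    (hbdd : ∀ r : Γ(X, U), ∃ C : ℝ, ∀ (x : Pt f L) (hx : ⊤ ≤ x.hom ⁻¹ᵁ U),
      (∀ i, ‖evalHom x.hom U hx (t i)‖ ≤ 1) → ‖evalHom x.hom U hx r‖ ≤ C) :
    IsCompact {x : Pt f L | ∃ hx : ⊤ ≤ x.hom ⁻¹ᵁ U, ∀ i, ‖evalHom x.hom U hx (t i)‖ ≤ 1} := by
  classical
  rw [isCompact_iff_ultrafilter_le_nhds]
  intro 𝒰 h𝒰
  have hS := Filter.le_principal_iff.mp h𝒰
  -- The value `0` outside `U` is never seen: the ultrafilter contains a set of points of `U`.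
  let val (r : Γ(X, U)) (x : Pt f L) : L :=
    if hx : ⊤ ≤ x.hom ⁻¹ᵁ U then evalHom x.hom U hx r else 0
  have hval {r : Γ(X, U)} {x : Pt f L} (hx : ⊤ ≤ x.hom ⁻¹ᵁ U) : val r x = evalHom x.hom U hx r :=
    dif_pos hx
  have hlim (r : Γ(X, U)) : ∃ a : L, Filter.Tendsto (val r) 𝒰 (𝓝 a) := by
    obtain ⟨C, hC⟩ := hbdd r
    obtain ⟨a, -, ha⟩ := (isCompact_closedBall (0 : L) C).ultrafilter_le_nhds (𝒰.map (val r)) (by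
      rw [Filter.le_principal_iff]
      refine Ultrafilter.mem_map.mpr (Filter.mem_of_superset hS ?_)
      rintro x ⟨hx, hxt⟩
      rw [Set.mem_preimage, hval hx, mem_closedBall_zero_iff]
      exact hC x hx hxt)
    exact ⟨a, ha⟩
  choose φ hφ using hlim
  have huniq {r : Γ(X, U)} {a : L} {v : Pt f L → L} (hv : Filter.Tendsto v 𝒰 (𝓝 a))
      (h : ∀ (x : Pt f L) (hx : ⊤ ≤ x.hom ⁻¹ᵁ U), evalHom x.hom U hx r = v x) : φ r = a := by
    refine tendsto_nhds_unique (hφ r) (hv.congr' (Filter.mem_of_superset hS ?_))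
    rintro x ⟨hx, -⟩
    exact ((hval hx).trans (h x hx)).symm
  -- Boundedness and properness of `L` give a limit along the ultrafilter for every function; the
  -- limits form a `K`-algebra homomorphism, that is, the limit point.
  let ψ : Γ(X, U) →+* L :=
    { toFun := φ
      map_zero' := huniq tendsto_const_nhds fun x hx ↦ map_zero _
      map_one' := huniq tendsto_const_nhds fun x hx ↦ map_one _
      map_add' := fun r s ↦ huniq ((hφ r).add (hφ s)) fun x hx ↦ by
        rw [map_add, hval hx, hval hx]
      map_mul' := fun r s ↦ huniq ((hφ r).mul (hφ s)) fun x hx ↦ by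
        rw [map_mul, hval hx, hval hx] }
  have hψ (r : Γ(X, U)) : Filter.Tendsto (val r) 𝒰 (𝓝 (ψ r)) := hφ r
  have hψc (c : K) : ψ (constants f U c) = algebraMap K L c :=
    huniq tendsto_const_nhds fun x hx ↦ evalHom_constants x hx c
  have hxU : ⊤ ≤ (Spec.map (CommRingCat.ofHom ψ) ≫ hU.fromSpec) ⁻¹ᵁ U := by
    rw [top_le_preimage_iff, Scheme.Hom.comp_apply, ← SetLike.mem_coe, ← hU.range_fromSpec]
    exact ⟨_, rfl⟩
  have hev (r : Γ(X, U)) :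
      evalHom (Spec.map (CommRingCat.ofHom ψ) ≫ hU.fromSpec) U hxU r = ψ r := by
    rw [evalHom_SpecMap_comp _ _ (hU.fromSpec_preimage_self.ge)]
    have h : hU.fromSpec.appLE U ⊤ hU.fromSpec_preimage_self.ge =
        (Scheme.ΓSpecIso Γ(X, U)).inv := by
      rw [Scheme.Hom.appLE, hU.fromSpec_app_self, Category.assoc, ← Functor.map_comp,
        ← Category.comp_id (Scheme.ΓSpecIso Γ(X, U)).inv, ← (Spec Γ(X, U)).presheaf.map_id]
      rfl
    rw [h]
    exact congrArg ψ ((Scheme.ΓSpecIso Γ(X, U)).commRingCatIsoToRingEquiv.apply_symm_apply r)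
  let x₀ : Pt f L := ⟨Spec.map (CommRingCat.ofHom ψ) ≫ hU.fromSpec, by
    have h1 := (isAffineOpen_top (Spec (.of K))).SpecMap_appLE_fromSpec f hU le_top
    rw [IsAffineOpen.fromSpec_top, Scheme.isoSpec_Spec_inv] at h1
    rw [Category.assoc, ← h1, ← Spec.map_comp, ← Spec.map_comp]
    congr 1
    ext c
    exact hψc c⟩
  refine ⟨x₀, ⟨hxU, fun i ↦ ?_⟩, ?_⟩
  · change ‖evalHom (Spec.map (CommRingCat.ofHom ψ) ≫ hU.fromSpec) U hxU (t i)‖ ≤ 1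
    rw [hev]
    refine le_of_tendsto (hψ (t i)).norm (Filter.mem_of_superset hS ?_)
    rintro x ⟨hx, hxt⟩
    rw [Set.mem_ofPred, hval hx]
    exact hxt i
  · refine (TopologicalSpace.tendsto_nhds_generateFrom_iff (m := id)).mpr ?_
    rintro _ ⟨V, h, O, hO, rfl⟩ ⟨hxV, hxO⟩
    have hxUV : x₀.hom (specPoint L) ∈ U := top_le_preimage_iff.mp hxU
    -- Near the limit point a function on another open set `V` is a fraction `r / g ^ n` of
    -- functions on `U`, so its values converge as well.
    obtain ⟨g, hgV, hxg⟩ := hU.exists_basicOpen_le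
      ⟨x₀.hom (specPoint L), top_le_preimage_iff.mp hxV⟩ hxUV
    have := hU.isLocalization_basicOpen g
    obtain ⟨⟨r, _, n, rfl⟩, hr⟩ := IsLocalization.surj (.powers g)
      (X.presheaf.map (homOfLE hgV).op h)
    have hquot (x : Pt f L) (hx : ⊤ ≤ x.hom ⁻¹ᵁ U) (hg : evalHom x.hom U hx g ≠ 0) :
        ∃ hx' : ⊤ ≤ x.hom ⁻¹ᵁ V,
          evalHom x.hom V hx' h = evalHom x.hom U hx r / evalHom x.hom U hx g ^ n := by
      have hxg := top_le_preimage_iff.mpr ((mem_basicOpen_iff_evalHom_ne_zero x.hom hx g).mpr hg)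
      refine ⟨hxg.trans (x.hom.preimage_mono hgV), ?_⟩
      rw [eq_div_iff (pow_ne_zero n hg)]
      have h1 := congrArg (evalHom x.hom _ hxg) hr
      rw [map_mul, evalHom_map] at h1
      erw [evalHom_map, evalHom_map] at h1
      rw [map_pow] at h1
      exact h1
    have hg₀ : ψ g ≠ 0 := by
      rw [← hev]
      exact (mem_basicOpen_iff_evalHom_ne_zero x₀.hom hxU g).mp hxg
    have hlim := (hψ r).div ((hψ g).pow n) (pow_ne_zero n hg₀)
    have hmem : ψ r / ψ g ^ n ∈ O := by
      obtain ⟨hx', he⟩ := hquot x₀ hxU (by rw [hev]; exact hg₀)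
      rw [← hev, ← hev, ← he]
      exact hxO
    filter_upwards [hS, (hψ g).eventually_ne hg₀, hlim.eventually (hO.mem_nhds hmem)]
    rintro x ⟨hx, -⟩ hg hO
    rw [hval hx] at hg
    simp only [Pi.div_apply, hval hx] at hO
    obtain ⟨hx', he⟩ := hquot x hx hg
    exact ⟨hx', (congrArg (· ∈ O) he).mpr hO⟩

end AnalyticTopology

/-! ### Analytic closedness of rational points of strata -/

section Closed

variable {K : Type u} [Field K] {X : Scheme.{u}} {f : X ⟶ Spec (.of K)}
variable {L : Type u} [NormedField L] [Algebra K L]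

lemma LogPair.Pt.top_le_section_preimage (y : Pt f L) {U : X.Opens}
    (hy : y.hom (specPoint L) ∈ U) :
    ⊤ ≤ y.sectionHom ⁻¹ᵁ (pullback.fst f (specMap K L) ⁻¹ᵁ U) := by
  rw [top_le_preimage_iff]
  change pullback.fst f (specMap K L) (y.sectionHom (specPoint L)) ∈ U
  rwa [← Scheme.Hom.comp_apply, Pt.sectionHom_fst]

lemma LogPair.evalHom_section_fst (y : Pt f L) {U : X.Opens} (hy : y.hom (specPoint L) ∈ U)
    (r : Γ(X, U)) :
    evalHom y.sectionHom _ (y.top_le_section_preimage hy)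
      ((pullback.fst f (specMap K L)).appLE U _ le_rfl r) =
      evalHom y.hom U (top_le_preimage_iff.mpr hy) r :=
  (evalHom_comp y.sectionHom (pullback.fst f (specMap K L)) le_rfl
    (y.top_le_section_preimage hy) r).symm.trans (evalHom_congr y.sectionHom_fst _ _ _)

lemma LogPair.evalHom_section_snd (y : Pt f L) {U : X.Opens} (hy : y.hom (specPoint L) ∈ U)
    (r : Γ(Spec (.of L), ⊤)) :
    evalHom y.sectionHom _ (y.top_le_section_preimage hy)
      ((pullback.snd f (specMap K L)).appLE ⊤ (pullback.fst f (specMap K L) ⁻¹ᵁ U) le_top r) =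
      evalHom (𝟙 (Spec (.of L))) ⊤ le_top r :=
  (evalHom_comp y.sectionHom (pullback.snd f (specMap K L)) le_top
    (y.top_le_section_preimage hy) r).symm.trans (evalHom_congr y.sectionHom_snd _ _ _)

/-- Over an affine open the sections of the fibre product are a pushout of rings. This reduces
continuity of functions on `X_L` to functions on `X` and constants of `L`, although the topology is
defined by functions on `X` alone. -/
lemma LogPair.closure_range_appLE_pullback {R S : CommRingCat.{u}} {Y : Scheme.{u}}
    (g : Y ⟶ Spec R) (h : Spec S ⟶ Spec R) {U : Y.Opens} (hU : IsAffineOpen U) :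
    Subring.closure (Set.range ((pullback.fst g h).appLE U (pullback.fst g h ⁻¹ᵁ U) le_rfl) ∪
      Set.range ((pullback.snd g h).appLE ⊤ (pullback.fst g h ⁻¹ᵁ U) le_top)) = ⊤ :=
  have hUY : pullback.fst g h ⁻¹ᵁ U = pullback.fst g h ⁻¹ᵁ U ⊓ pullback.snd g h ⁻¹ᵁ ⊤ :=
    (inf_top_eq _).symm
  CommRingCat.closure_range_union_range_of_isPushout
    ((isIso_pushoutSection_iff (IsPullback.of_hasPullback g h) (US := ⊤) (UT := ⊤)
      (UX := U) le_top le_top hUY).mp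
      (isIso_pushoutSection_of_isAffineOpen _ _ _ _ (isAffineOpen_top _) (isAffineOpen_top _) hU))

lemma continuous_ringHom_apply_of_closure_eq_top {T P : Type*} [TopologicalSpace T] [Ring P]
    {L : Type*} [Ring L] [TopologicalSpace L] [IsTopologicalRing L] {s : Set P}
    (hs : Subring.closure s = ⊤) (e : T → P →+* L) (h : ∀ a ∈ s, Continuous fun y ↦ e y a)
    (a : P) : Continuous fun y ↦ e y a := by
  induction hs.ge (Subring.mem_top a) using Subring.closure_induction with
  | mem a ha => exact h a ha
  | zero => simpa only [map_zero] using continuous_const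
  | one => simpa only [map_one] using continuous_const
  | add a b _ _ ha hb => exact (ha.add hb).congr fun y ↦ (map_add _ _ _).symm
  | neg a _ ha => exact ha.neg.congr fun y ↦ (map_neg _ _).symm
  | mul a b _ _ ha hb => exact (ha.mul hb).congr fun y ↦ (map_mul _ _ _).symm

/-- Regular functions on the preimage in `X_L` of an affine open subset of `X` are analytically
continuous. -/
lemma LogPair.continuous_evalHom_section {U : X.Opens} (hU : IsAffineOpen U)
    (s : Γ(baseChange f L, pullback.fst f (specMap K L) ⁻¹ᵁ U)) :
    Continuous fun y : {y : Pt f L // y.hom (specPoint L) ∈ U} ↦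
      evalHom y.1.sectionHom _ (y.1.top_le_section_preimage y.2) s := by
  refine continuous_ringHom_apply_of_closure_eq_top
    (closure_range_appLE_pullback f (specMap K L) hU)
    (fun y : {y : Pt f L // y.hom (specPoint L) ∈ U} ↦
      evalHom y.1.sectionHom _ (y.1.top_le_section_preimage y.2)) ?_ s
  rintro _ (⟨r, rfl⟩ | ⟨r, rfl⟩)
  · have h : Continuous fun y : {y : Pt f L // y.hom (specPoint L) ∈ U} ↦
        evalHom y.1.hom U (top_le_preimage_iff.mpr y.2) r := by
      refine continuous_def.mpr fun O' hO' ↦ ?_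
      convert (isOpen_setOf_evalHom_mem (f := f) U r hO').preimage continuous_subtype_val using 1
      ext y
      exact ⟨fun h ↦ ⟨_, h⟩, fun ⟨_, h⟩ ↦ h⟩
    exact h.congr fun y ↦ (evalHom_section_fst y.1 y.2 r).symm
  · exact continuous_const.congr fun y ↦ (evalHom_section_snd y.1 y.2 r).symm

lemma LogPair.isOpen_setOf_section_mem_basicOpen {U : X.Opens} (hU : IsAffineOpen U)
    (s : Γ(baseChange f L, pullback.fst f (specMap K L) ⁻¹ᵁ U)) :
    IsOpen {y : {y : Pt f L // y.hom (specPoint L) ∈ U} |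
      y.1.sectionHom (specPoint L) ∈ (baseChange f L).basicOpen s} := by
  have h : {y : {y : Pt f L // y.hom (specPoint L) ∈ U} |
      y.1.sectionHom (specPoint L) ∈ (baseChange f L).basicOpen s} =
      (fun y ↦ evalHom y.1.sectionHom _ (y.1.top_le_section_preimage y.2) s) ⁻¹' {0}ᶜ :=
    Set.ext fun y ↦ mem_basicOpen_iff_evalHom_ne_zero _ (y.1.top_le_section_preimage y.2) s
  rw [h]
  exact isOpen_compl_singleton.preimage (continuous_evalHom_section hU s)

/-- The set of rational points of `X` whose associated point of `X_L` lies in a Zariski-open subset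
is open in the analytic topology. -/
lemma LogPair.isOpen_setOf_section_mem (O : (baseChange f L).Opens) :
    IsOpen {x : Pt f L | x.sectionHom (specPoint L) ∈ O} := by
  rw [isOpen_iff_mem_nhds]
  intro x hx
  obtain ⟨_, ⟨U, hU, rfl⟩, hxU, -⟩ := X.isBasis_affineOpens.exists_subset_of_mem_open
    (Set.mem_univ (x.hom (specPoint L))) isOpen_univ
  have : IsAffineHom (pullback.fst f (specMap K L)) :=
    MorphismProperty.of_isPullback (IsPullback.of_hasPullback _ _).flip
      (inferInstanceAs (IsAffineHom (specMap K L)))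
  have hpU : IsAffineOpen (pullback.fst f (specMap K L) ⁻¹ᵁ U) := hU.preimage _
  obtain ⟨s, hsO, hxs⟩ := hpU.exists_basicOpen_le ⟨x.sectionHom (specPoint L), hx⟩
    (top_le_preimage_iff.mp (x.top_le_section_preimage hxU))
  have hUo : IsOpen {y : Pt f L | y.hom (specPoint L) ∈ U} := isOpen_setOf_mem U
  have hs := hUo.isOpenMap_subtype_val _ (isOpen_setOf_section_mem_basicOpen hU s)
  refine Filter.mem_of_superset (hs.mem_nhds ⟨⟨x, hxU⟩, hxs, rfl⟩) ?_
  rintro _ ⟨y, hy, rfl⟩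
  exact hsO hy

/-- The rational points of a closed subset that is defined over `L` form an analytically closed
set. -/
lemma LogPair.isClosed_ratPts {Kbar : Type u} [Field Kbar] [Algebra K Kbar]
    (σ : Kbar →ₐ[K] AlgebraicClosure L) {Z : Closeds (baseChange f Kbar)} (hZ : DefinedOver σ Z) :
    IsClosed (ratPts σ Z : Set (Pt f L)) := by
  obtain ⟨Y, hY⟩ := hZ
  have h : (ratPts σ Z : Set (Pt f L)) = {x | x.sectionHom (specPoint L) ∈ Y.compl}ᶜ := by
    ext x
    have h : baseChangeMap f σ (x.closureSection (specPoint _)) ∈ Z ↔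
        baseChangeMap f (IsScalarTower.toAlgHom K L (AlgebraicClosure L))
          (x.closureSection (specPoint _)) ∈ Y :=
      SetLike.ext_iff.mp hY (x.closureSection (specPoint _))
    rw [← Scheme.Hom.comp_apply,
      ← Scheme.Hom.comp_apply, Pt.closureSection_baseChangeMap, Pt.closureSection_toAlgHom,
      Scheme.Hom.comp_apply, eq_specPoint (specMap L (AlgebraicClosure L) _)] at h
    rw [mem_ratPts_iff, h]
    exact not_not.symm
  rw [h]
  exact (isOpen_setOf_section_mem _).isClosed_compl

end Closed

/-! ### Coordinates on the standard charts of projective space -/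

section ProjectiveCoordinates

open MvPolynomial HomogeneousLocalization

attribute [local instance] MvPolynomial.gradedAlgebra

/-- Two ring homomorphisms agreeing on constants, whose values on the variables differ by a factor
`u`, differ by `u ^ n` on homogeneous polynomials of degree `n`. -/
lemma MvPolynomial.IsHomogeneous.map_eq_pow_mul {σ R S : Type*} [CommRing R] [CommRing S]
    {p : MvPolynomial σ R} {n : ℕ} (hp : p.IsHomogeneous n) (g₁ g₂ : MvPolynomial σ R →+* S) (u : S)
    (hC : ∀ c, g₁ (C c) = g₂ (C c)) (hX : ∀ i, g₁ (X i) = u * g₂ (X i)) :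
    g₁ p = u ^ n * g₂ p := by
  conv_lhs => rw [p.as_sum]
  conv_rhs => rw [p.as_sum]
  rw [map_sum, map_sum, Finset.mul_sum]
  refine Finset.sum_congr rfl fun d hd ↦ ?_
  have hdn : ∏ i ∈ d.support, u ^ d i = u ^ n := by
    rw [Finset.prod_pow_eq_pow_sum]
    congr 1
    by_contra h
    exact mem_support_iff.mp hd (hp.coeff_eq_zero h)
  rw [monomial_eq, map_mul, map_mul, hC, Finsupp.prod, map_prod, map_prod]
  simp_rw [map_pow, hX, mul_pow]
  rw [Finset.prod_mul_distrib, hdn]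
  ring

lemma MvPolynomial.exists_norm_eval₂_le {σ R L : Type*} [CommRing R] [NormedField L] (φ : R →+* L)
    (p : MvPolynomial σ R) : ∃ B : ℝ, ∀ z : σ → L, (∀ i, ‖z i‖ ≤ 1) → ‖eval₂ φ z p‖ ≤ B := by
  induction p using MvPolynomial.induction_on with
  | C a => exact ⟨‖φ a‖, fun z _ ↦ by rw [eval₂_C]⟩
  | add p q hp hq =>
    obtain ⟨B, hB⟩ := hp
    obtain ⟨B', hB'⟩ := hq
    refine ⟨B + B', fun z hz ↦ ?_⟩
    rw [eval₂_add]
    exact (norm_add_le _ _).trans (add_le_add (hB z hz) (hB' z hz))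
  | mul_X p i hp =>
    obtain ⟨B, hB⟩ := hp
    refine ⟨B, fun z hz ↦ ?_⟩
    rw [eval₂_mul, eval₂_X, norm_mul]
    exact (mul_le_of_le_one_right (norm_nonneg _) (hz i)).trans (hB z hz)

variable {σ : Type*} {K : Type u} [Field K]

lemma MvPolynomial.X_mem_homogeneousSubmodule_one (i : σ) :
    X i ∈ homogeneousSubmodule σ K 1 :=
  isHomogeneous_X K i

/-- The coordinate function `x_i / x_j` on the standard affine open `D₊(x_j)`. -/
noncomputable def LogPair.affineCoord (i j : σ) : Away (homogeneousSubmodule σ K) (X j) :=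
  Away.mk _ (X_mem_homogeneousSubmodule_one j) 1 (X i)
    (X_mem_homogeneousSubmodule_one i)

lemma LogPair.val_affineCoord (i j : σ) : (affineCoord (K := K) i j).val =
    Localization.mk (X i) ⟨X j, Submonoid.mem_powers _⟩ := by
  refine (Away.val_mk _ _ _ _ _).trans ?_
  simp only [pow_one]

lemma LogPair.affineCoord_self (j : σ) : affineCoord (K := K) j j = 1 := by
  apply val_injective
  rw [val_affineCoord, val_one]
  exact Localization.mk_self ⟨(X j : MvPolynomial σ K), Submonoid.mem_powers _⟩

/-- The elements of the coordinate ring of `D₊(x_j)` are polynomials in the `x_i / x_j`. -/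
lemma LogPair.exists_eq_eval₂_affineCoord (j : σ) (a : Away (homogeneousSubmodule σ K) (X j)) :
    ∃ p : MvPolynomial σ K, a = eval₂ ((fromZeroRingHom (homogeneousSubmodule σ K) _).comp
      (algebraMap K (homogeneousSubmodule σ K 0))) (affineCoord · j) p := by
  obtain ⟨n, p, hp, rfl⟩ := Away.mk_surjective _ (X_mem_homogeneousSubmodule_one j) a
  refine ⟨p, ?_⟩
  rw [smul_eq_mul, mul_one] at hp
  apply val_injective
  let S := Localization (Submonoid.powers (X j : MvPolynomial σ K))
  let θ := eval₂Hom ((fromZeroRingHom (homogeneousSubmodule σ K) (Submonoid.powers (X j))).comp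
      (algebraMap K (homogeneousSubmodule σ K 0))) (affineCoord · j)
  have hS (q : MvPolynomial σ K) (m : ℕ) : (Localization.mk q ⟨X j ^ m, pow_mem (Submonoid.mem_powers _) m⟩ : S) *
      algebraMap (MvPolynomial σ K) S (X j) ^ m = algebraMap _ S q := by
    rw [← map_pow, ← Localization.mk_one_eq_algebraMap, ← Localization.mk_one_eq_algebraMap,
      Localization.mk_mul, Localization.mk_eq_mk_iff, Localization.r_iff_exists]
    exact ⟨1, by simp; ring⟩
  -- Dehomogenization: `p = x_j ^ n * p(x_i / x_j)` for `p` homogeneous of degree `n`.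
  have key : algebraMap (MvPolynomial σ K) S p =
      algebraMap (MvPolynomial σ K) S (X j) ^ n * (θ p).val := by
    refine IsHomogeneous.map_eq_pow_mul hp (algebraMap (MvPolynomial σ K) S)
      ((algebraMap _ S).comp θ) (algebraMap _ S (X j)) ?_ ?_
    · intro c
      rw [RingHom.comp_apply, coe_eval₂Hom, eval₂_C]
      exact (Localization.mk_one_eq_algebraMap _).symm
    · intro i
      rw [RingHom.comp_apply, coe_eval₂Hom, eval₂_X, HomogeneousLocalization.algebraMap_apply,
        val_affineCoord, mul_comm]
      simpa using (hS (X i) 1).symm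
  have hu : IsUnit (algebraMap (MvPolynomial σ K) S (X j) ^ n) :=
    (IsLocalization.map_units S (⟨X j, Submonoid.mem_powers _⟩ :
      Submonoid.powers (X j : MvPolynomial σ K))).pow n
  rw [Away.val_mk]
  refine hu.mul_left_injective ?_
  change _ * _ = (θ p).val * _
  rw [hS, key, mul_comm]

lemma LogPair.awayMap_affineCoord_mul (i j k : σ) :
    awayMap (homogeneousSubmodule σ K) (X_mem_homogeneousSubmodule_one k) rfl (affineCoord i j) =
      awayMap (homogeneousSubmodule σ K) (X_mem_homogeneousSubmodule_one j) (mul_comm (X j) (X k))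
        (affineCoord i k) *
      awayMap (homogeneousSubmodule σ K) (X_mem_homogeneousSubmodule_one k) rfl (affineCoord k j) := by
  apply val_injective
  rw [val_mul, affineCoord, affineCoord, affineCoord, awayMap_mk, awayMap_mk, awayMap_mk,
    Away.val_mk, Away.val_mk, Away.val_mk, Localization.mk_mul, Localization.mk_eq_mk_iff,
    Localization.r_iff_exists]
  exact ⟨1, by simp; ring⟩

end ProjectiveCoordinates

/-! ### Field-valued points of `Proj` -/

section ProjPoints

open HomogeneousLocalization

variable {τ : Type*} {A : Type u} [CommRing A] [SetLike τ A] [AddSubgroupClass τ A] {𝒜 : ℕ → τ}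
  [GradedRing 𝒜] {L : Type u} [Field L]

/-- Evaluation of degree zero fractions at a point of `D₊(f)`. -/
noncomputable def LogPair.evalAway (y : Spec (.of L) ⟶ Proj 𝒜) (f : A)
    (hy : ⊤ ≤ y ⁻¹ᵁ Proj.basicOpen 𝒜 f) : Away 𝒜 f →+* L :=
  (evalHom y _ hy).comp (Proj.awayToSection 𝒜 f).hom

lemma LogPair.evalAway_awayMap (y : Spec (.of L) ⟶ Proj 𝒜) {f g x : A} {m : ℕ} (hg : g ∈ 𝒜 m)
    (hx : x = f * g) (hyx : ⊤ ≤ y ⁻¹ᵁ Proj.basicOpen 𝒜 x) (hyf : ⊤ ≤ y ⁻¹ᵁ Proj.basicOpen 𝒜 f)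
    (a : Away 𝒜 f) : evalAway y x hyx (awayMap 𝒜 hg hx a) = evalAway y f hyf a := by
  have h := DFunLike.congr_fun (congrArg CommRingCat.Hom.hom
    (Proj.awayMap_awayToSection 𝒜 (f := f) hg hx)) a
  exact (congrArg (evalHom y _ hyx) h).trans (evalHom_map y _ hyx _)

lemma LogPair.basicOpen_ι_toSpecZero {f : A} {m : ℕ} (hf : f ∈ 𝒜 m) (hm : 0 < m) :
    (Proj.basicOpen 𝒜 f).ι ≫ Proj.toSpecZero 𝒜 =
      Proj.basicOpenToSpec 𝒜 f ≫ Spec.map (CommRingCat.ofHom (fromZeroRingHom 𝒜 _)) := by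
  rw [← Proj.awayι_toSpecZero 𝒜 f hf hm, ← Proj.basicOpenIsoSpec_inv_ι,
    ← Proj.basicOpenIsoSpec_hom 𝒜 f hf hm, Category.assoc, Iso.hom_inv_id_assoc]

lemma LogPair.evalHom_comp_SpecMap {X : Scheme.{u}} {R S : CommRingCat.{u}} (z : X ⟶ Spec S)
    (y : Spec (.of L) ⟶ X) (φ : R ⟶ S) (c : R) :
    evalHom (y ≫ z ≫ Spec.map φ) ⊤ le_top ((Scheme.ΓSpecIso R).inv c) =
      evalHom (y ≫ z) ⊤ le_top ((Scheme.ΓSpecIso S).inv (φ c)) := by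
  have h := Scheme.ΓSpecIso_inv_naturality φ
  rw [Scheme.Hom.appTop, Scheme.Hom.app_eq_appLE] at h
  refine (evalHom_congr (Category.assoc _ _ _).symm _ le_top _).trans
    ((evalHom_comp (y ≫ z) (Spec.map φ) (U := ⊤) (V := ⊤) le_top le_top _).trans
      (congrArg (evalHom (y ≫ z) ⊤ le_top) ?_))
  exact (DFunLike.congr_fun (congrArg CommRingCat.Hom.hom h) c).symm

lemma LogPair.evalHom_SpecMap {R : CommRingCat.{u}} (φ : R ⟶ .of L) (c : R) :
    evalHom (Spec.map φ) ⊤ le_top ((Scheme.ΓSpecIso R).inv c) = φ c := by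
  have h := Scheme.ΓSpecIso_naturality φ
  rw [Scheme.Hom.appTop, Scheme.Hom.app_eq_appLE] at h
  refine (ConcreteCategory.congr_hom h ((Scheme.ΓSpecIso R).inv c)).trans ?_
  simp

lemma LogPair.evalAway_fromZeroRingHom (y : Spec (.of L) ⟶ Proj 𝒜) {f : A} {m : ℕ} (hf : f ∈ 𝒜 m)
    (hm : 0 < m) (hy : ⊤ ≤ y ⁻¹ᵁ Proj.basicOpen 𝒜 f) {φ : CommRingCat.of (𝒜 0) ⟶ .of L}
    (hφ : y ≫ Proj.toSpecZero 𝒜 = Spec.map φ) (a : 𝒜 0) :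
    evalAway y f hy (fromZeroRingHom 𝒜 _ a) = φ a := by
  let U := Proj.basicOpen 𝒜 f
  have hr : Set.range y ⊆ Set.range U.ι := by
    rintro _ ⟨p, rfl⟩
    rw [Scheme.Opens.range_ι]
    exact hy (Set.mem_univ p)
  let y' := IsOpenImmersion.lift U.ι y hr
  have hy' : y' ≫ U.ι = y := IsOpenImmersion.lift_fac _ _ _
  have hι : U.ι.appLE U ⊤ (U.ι_preimage_self.ge) = U.topIso.inv := by
    rw [Scheme.Opens.ι_appLE, Scheme.Opens.topIso_inv]
    rfl
  have h1 (s : Γ(Proj 𝒜, U)) : evalHom y U hy s = evalHom y' ⊤ le_top (U.topIso.inv s) := by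
    rw [← hι]
    exact (evalHom_congr hy'.symm hy (hy'.symm ▸ hy) s).trans
      (evalHom_comp y' U.ι U.ι_preimage_self.ge le_top s)
  have h2 : U.topIso.inv (Proj.awayToSection 𝒜 f (fromZeroRingHom 𝒜 _ a)) =
      (Proj.basicOpenToSpec 𝒜 f).appLE ⊤ ⊤ le_top
        ((Scheme.ΓSpecIso _).inv (fromZeroRingHom 𝒜 _ a)) := by
    have h := Proj.basicOpenToSpec_app_top 𝒜 f
    rw [Scheme.Hom.app_eq_appLE] at h
    refine .symm ((ConcreteCategory.congr_hom h _).trans ?_)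
    exact congrArg (Proj.awayToSection 𝒜 f ≫ U.topIso.inv).hom
      ((Scheme.ΓSpecIso _).commRingCatIsoToRingEquiv.apply_symm_apply _)
  refine (h1 _).trans ?_
  refine (congrArg (evalHom y' ⊤ le_top) h2).trans ?_
  refine (evalHom_comp y' (Proj.basicOpenToSpec 𝒜 f) (U := ⊤) (V := ⊤) le_top
    le_top _).symm.trans ?_
  refine (evalHom_comp_SpecMap (Proj.basicOpenToSpec 𝒜 f) y'
    (CommRingCat.ofHom (fromZeroRingHom 𝒜 (Submonoid.powers f))) a).symm.trans ?_
  refine (evalHom_congr ?_ le_top le_top _).trans (evalHom_SpecMap φ a)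
  rw [← basicOpen_ι_toSpecZero hf hm, ← Category.assoc, hy', hφ]

/-- A fraction `g / f` with nonzero value is a unit in the stalk, a homogeneous localization, so `g`
avoids the corresponding prime. -/
lemma LogPair.mem_basicOpen_of_evalAway_ne_zero (y : Spec (.of L) ⟶ Proj 𝒜) {f g : A} {m : ℕ}
    (hf : f ∈ 𝒜 m) (hg : g ∈ 𝒜 (1 • m)) (hy : ⊤ ≤ y ⁻¹ᵁ Proj.basicOpen 𝒜 f)
    (h : evalAway y f hy (Away.mk 𝒜 hf 1 g hg) ≠ 0) :
    y (specPoint L) ∈ Proj.basicOpen 𝒜 g := by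
  have hyf := top_le_preimage_iff.mp hy
  have h1 := (mem_basicOpen_iff_evalHom_ne_zero y hy _).mpr h
  rw [Scheme.mem_basicOpen _ _ _ hyf] at h1
  let p : ProjectiveSpectrum 𝒜 := y (specPoint L)
  let φ := HomogeneousLocalization.mapId 𝒜
    (Submonoid.powers_le.mpr (show f ∈ p.asHomogeneousIdeal.toIdeal.primeCompl from hyf))
  have h2 : ((Proj 𝒜).presheaf.germ _ (y (specPoint L)) hyf).hom
      ((Proj.awayToSection 𝒜 f).hom (Away.mk 𝒜 hf 1 g hg)) =
    (Proj.stalkIso' 𝒜 p).symm (φ (Away.mk 𝒜 hf 1 g hg)) :=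
    DFunLike.congr_fun (congrArg CommRingCat.Hom.hom
      (ProjectiveSpectrum.Proj.awayToSection_germ 𝒜 f (y (specPoint L)) hyf)) _
  rw [h2] at h1
  have h3 := (MulEquiv.isUnit_map _).mp h1
  have h4 := (isUnit_iff_isUnit_val 𝒜 p.asHomogeneousIdeal.toIdeal _).mpr h3
  have h5 : (φ (Away.mk 𝒜 hf 1 g hg)).val = Localization.mk g ⟨f ^ 1, by
    rw [pow_one]; exact hyf⟩ := rfl
  rw [h5, Localization.mk_eq_mk', IsLocalization.AtPrime.isUnit_mk'_iff] at h4
  exact h4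

end ProjPoints

/-! ### Compactness of the rational points of a projective variety -/

section Compactness

open MvPolynomial HomogeneousLocalization

attribute [local instance] MvPolynomial.gradedAlgebra

lemma MvPolynomial.iSup_basicOpen_X_eq_top {σ : Type} {K : Type u} [Field K] :
    ⨆ j : σ, Proj.basicOpen (homogeneousSubmodule σ K) (X j) = ⊤ := by
  refine Proj.iSup_basicOpen_eq_top' _ _ (fun j ↦ ⟨1, X_mem_homogeneousSubmodule_one j⟩) ?_
  rw [eq_top_iff]
  intro p _
  induction p using MvPolynomial.induction_on with
  | C a => exact Subalgebra.algebraMap_mem _ (⟨C a, isHomogeneous_C σ a⟩ :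
      homogeneousSubmodule σ K 0)
  | add p q hp hq => exact add_mem (hp trivial) (hq trivial)
  | mul_X p i hp => exact mul_mem (hp trivial) (Algebra.subset_adjoin ⟨i, rfl⟩)

variable {K : Type u} [Field K] {X : Scheme.{u}} {f : X ⟶ Spec (.of K)} {σ : Type}
  {i : X ⟶ Proj (homogeneousSubmodule σ K)}

/-- Evaluation on a chart is `K`-linear because the embedding is a morphism over `K`. The bounds on
polynomials in the coordinates need this. -/
lemma LogPair.evalAway_algebraMap
    (hi : i ≫ Proj.toSpecZero (homogeneousSubmodule σ K) ≫ Spec.map (CommRingCat.ofHom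
      (algebraMap K (homogeneousSubmodule σ K 0))) = f)
    {L : Type u} [Field L] [Algebra K L] (x : Pt f L) (j : σ)
    (hx : ⊤ ≤ (x.hom ≫ i) ⁻¹ᵁ Proj.basicOpen (homogeneousSubmodule σ K) (MvPolynomial.X j)) :
    ((evalAway (x.hom ≫ i) _ hx).comp (fromZeroRingHom (homogeneousSubmodule σ K) _)).comp
      (algebraMap K (homogeneousSubmodule σ K 0)) = algebraMap K L := by
  obtain ⟨φ, hφ⟩ := Spec.map_surjective ((x.hom ≫ i) ≫ Proj.toSpecZero (homogeneousSubmodule σ K))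
  have h : CommRingCat.ofHom (algebraMap K (homogeneousSubmodule σ K 0)) ≫ φ =
      CommRingCat.ofHom (algebraMap K L) := by
    apply Spec.map_injective
    rw [Spec.map_comp, hφ, Category.assoc, Category.assoc, hi, x.comp_eq]
  ext c
  refine (evalAway_fromZeroRingHom _ (X_mem_homogeneousSubmodule_one j) one_pos hx
    hφ.symm _).trans ?_
  exact DFunLike.congr_fun (congrArg CommRingCat.Hom.hom h) c

lemma LogPair.evalAway_affineCoord_mul {L : Type u} [Field L]
    (y : Spec (.of L) ⟶ Proj (homogeneousSubmodule σ K)) {j k : σ}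
    (hj : ⊤ ≤ y ⁻¹ᵁ Proj.basicOpen (homogeneousSubmodule σ K) (MvPolynomial.X j))
    (hk : ⊤ ≤ y ⁻¹ᵁ Proj.basicOpen (homogeneousSubmodule σ K) (MvPolynomial.X k)) (l : σ) :
    evalAway y _ hj (affineCoord l j) =
      evalAway y _ hk (affineCoord l k) * evalAway y _ hj (affineCoord k j) := by
  have hjk : ⊤ ≤ y ⁻¹ᵁ Proj.basicOpen (homogeneousSubmodule σ K)
      (MvPolynomial.X j * MvPolynomial.X k) := by
    rw [Proj.basicOpen_mul]
    exact le_inf hj hk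
  have h := congrArg (evalAway y _ hjk) (awayMap_affineCoord_mul (K := K) l j k)
  rw [map_mul, evalAway_awayMap y _ _ hjk hj, evalAway_awayMap y _ _ hjk hj,
    evalAway_awayMap y _ _ hjk hk] at h
  exact h

/-- The rational points of a projective variety over a locally compact field form a compact
space. -/
theorem LogPair.compactSpace_pt (hproj : IsProjectiveOver f) {L : Type u} [NormedField L]
    [ProperSpace L] [Algebra K L] : CompactSpace (Pt f L) := by
  obtain ⟨n, i, hi, hif⟩ := hproj
  let 𝒜 := homogeneousSubmodule (Fin (n + 1)) K
  let x (j : Fin (n + 1)) : MvPolynomial (Fin (n + 1)) K := MvPolynomial.X j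
  have hxA (j) : IsAffineOpen (Proj.basicOpen 𝒜 (x j)) :=
    Proj.isAffineOpen_basicOpen 𝒜 (x j) (X_mem_homogeneousSubmodule_one j) one_pos
  let U (j) : X.Opens := i ⁻¹ᵁ Proj.basicOpen 𝒜 (x j)
  let τ (j) (a : Away 𝒜 (x j)) : Γ(X, U j) :=
    i.appLE (Proj.basicOpen 𝒜 (x j)) (U j) le_rfl (Proj.awayToSection 𝒜 (x j) a)
  have hτ {y : Pt f L} {j} (hy : ⊤ ≤ y.hom ⁻¹ᵁ U j) (a : Away 𝒜 (x j)) :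
      evalHom y.hom (U j) hy (τ j a) = evalAway (y.hom ≫ i) (x j) hy a :=
    (evalHom_comp y.hom i le_rfl hy _).symm
  have hτs (j) : Function.Surjective (τ j) := by
    intro r
    obtain ⟨s, rfl⟩ := i.app_surjective _ (hxA j) r
    have h := Proj.basicOpenIsoAway_hom 𝒜 (x j) (X_mem_homogeneousSubmodule_one j) one_pos
    refine ⟨(Proj.basicOpenIsoAway 𝒜 (x j) (X_mem_homogeneousSubmodule_one j) one_pos).inv s, ?_⟩
    simp only [τ]
    rw [← h, ← Scheme.Hom.app_eq_appLE]
    exact congrArg (i.app _) ((Proj.basicOpenIsoAway 𝒜 (x j)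
      (X_mem_homogeneousSubmodule_one j) one_pos).commRingCatIsoToRingEquiv.apply_symm_apply s)
  -- The polydisc where `x_j` is a coordinate of largest norm. Functions on the chart are
  -- polynomials in the `x_k / x_j`, hence bounded on it.
  let S (j) : Set (Pt f L) :=
    {y | ∃ hy : ⊤ ≤ y.hom ⁻¹ᵁ U j, ∀ k, ‖evalHom y.hom (U j) hy (τ j (affineCoord k j))‖ ≤ 1}
  have hS (j) : IsCompact (S j) := by
    refine isCompact_setOf_norm_evalHom_le ((hxA j).preimage i) _ fun r ↦ ?_
    obtain ⟨a, rfl⟩ := hτs j r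
    obtain ⟨p, rfl⟩ := exists_eq_eval₂_affineCoord j a
    obtain ⟨B, hB⟩ := MvPolynomial.exists_norm_eval₂_le (algebraMap K L) p
    refine ⟨B, fun y hy hle ↦ ?_⟩
    rw [hτ hy, MvPolynomial.hom_eval₂, ← RingHom.comp_assoc]
    refine (congrArg (fun φ ↦ ‖eval₂ φ _ p‖) (evalAway_algebraMap hif y j hy)).trans_le
      (hB _ fun k ↦ ?_)
    rw [← hτ hy]
    exact hle k
  refine ⟨(isCompact_iUnion hS).of_isClosed_subset isClosed_univ fun y _ ↦ ?_⟩
  have hcov := MvPolynomial.iSup_basicOpen_X_eq_top (σ := Fin (n + 1)) (K := K)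
  obtain ⟨j, hj⟩ := Opens.mem_iSup.mp (hcov.ge (Set.mem_univ ((y.hom ≫ i) (specPoint L))))
  have hyj : ⊤ ≤ (y.hom ≫ i) ⁻¹ᵁ Proj.basicOpen 𝒜 (x j) := top_le_preimage_iff.mpr hj
  -- Changing to the chart of a largest coordinate puts the point in a polydisc; this coordinate is
  -- nonzero since `x_j / x_j = 1`.
  obtain ⟨k, hk⟩ := Finite.exists_max fun k ↦ ‖evalAway (y.hom ≫ i) (x j) hyj (affineCoord k j)‖
  have h0 : 0 < ‖evalAway (y.hom ≫ i) (x j) hyj (affineCoord k j)‖ := by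
    refine lt_of_lt_of_le ?_ (hk j)
    rw [affineCoord_self, map_one, norm_one]
    exact one_pos
  have hyk : ⊤ ≤ (y.hom ≫ i) ⁻¹ᵁ Proj.basicOpen 𝒜 (x k) := top_le_preimage_iff.mpr
    (mem_basicOpen_of_evalAway_ne_zero _ (X_mem_homogeneousSubmodule_one j)
      (X_mem_homogeneousSubmodule_one k) hyj (norm_pos_iff.mp h0))
  refine Set.mem_iUnion.mpr ⟨k, hyk, fun l ↦ ?_⟩
  have h := hk l
  rw [evalAway_affineCoord_mul _ hyj hyk, norm_mul] at h
  rw [hτ hyk]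
  exact le_of_mul_le_mul_right (h.trans_eq (one_mul _).symm) h0

lemma LogPair.IsProjectiveOver.compactSpace (hproj : IsProjectiveOver f) : CompactSpace X := by
  obtain ⟨n, i, hi, -⟩ := hproj
  have : CompactSpace (Proj (homogeneousSubmodule (Fin (n + 1)) K)) := by
    rw [← isCompact_univ_iff, ← Opens.coe_top, ← MvPolynomial.iSup_basicOpen_X_eq_top,
      Opens.coe_iSup]
    exact isCompact_iUnion fun j ↦ (Proj.isAffineOpen_basicOpen _ _
      (X_mem_homogeneousSubmodule_one j) one_pos).isCompact
  exact i.isClosedEmbedding.compactSpace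

end Compactness

/-! ### Bounded denominators at integral points -/

section Denominators

/-- Denominators can be cleared for the generators, and sums and products only multiply
denominators. -/
lemma exists_mul_mem_range_of_closure_eq_top {R F A P : Type*} [CommRing R] [IsDomain R] [Field F]
    [Algebra R F] [IsFractionRing R F] [CommRing A] [CommRing P] {i : A →+* P} {j : F →+* P}
    {s : R →+* A} (hs : i.comp s = j.comp (algebraMap R F))
    (h : Subring.closure (Set.range i ∪ Set.range j) = ⊤) (g : P) :
    ∃ a : R, a ≠ 0 ∧ ∃ r : A, j (algebraMap R F a) * g = i r := by
  have hs' (a : R) : j (algebraMap R F a) = i (s a) := (DFunLike.congr_fun hs a).symm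
  induction h.ge (Subring.mem_top g) using Subring.closure_induction with
  | mem g hg =>
    obtain ⟨r, rfl⟩ | ⟨k, rfl⟩ := hg
    · exact ⟨1, one_ne_zero, r, by rw [map_one, map_one, one_mul]⟩
    · obtain ⟨n, d, hd, rfl⟩ := IsFractionRing.div_surjective (A := R) k
      refine ⟨d, nonZeroDivisors.ne_zero hd, s n, ?_⟩
      rw [← hs', ← map_mul, mul_div_cancel₀]
      exact IsFractionRing.to_map_ne_zero_of_mem_nonZeroDivisors hd
  | zero => exact ⟨1, one_ne_zero, 0, by rw [mul_zero, map_zero]⟩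
  | one => exact ⟨1, one_ne_zero, 1, by simp only [map_one, one_mul]⟩
  | add g g' _ _ hg hg' =>
    obtain ⟨a, ha, r, hr⟩ := hg
    obtain ⟨a', ha', r', hr'⟩ := hg'
    refine ⟨a * a', mul_ne_zero ha ha', s a' * r + s a * r', ?_⟩
    rw [map_add, map_mul, map_mul, map_mul, map_mul, ← hr, ← hr', ← hs', ← hs']
    ring
  | neg g _ hg =>
    obtain ⟨a, ha, r, hr⟩ := hg
    exact ⟨a, ha, -r, by rw [map_neg, ← hr, mul_neg]⟩
  | mul g g' _ _ hg hg' =>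
    obtain ⟨a, ha, r, hr⟩ := hg
    obtain ⟨a', ha', r', hr'⟩ := hg'
    refine ⟨a * a', mul_ne_zero ha ha', r * r', ?_⟩
    rw [map_mul i, map_mul, map_mul, ← hr, ← hr']
    ring

lemma AlgebraicGeometry.Scheme.Hom.appTop_comp_ΓSpecIso_inv {R S : CommRingCat.{u}}
    {P Y : Scheme.{u}} (p : P ⟶ Y) (q : P ⟶ Spec S) (s : Y ⟶ Spec R) (φ : R ⟶ S)
    (h : p ≫ s = q ≫ Spec.map φ) :
    ((Scheme.ΓSpecIso R).inv ≫ s.appTop) ≫ p.appTop =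
      φ ≫ (Scheme.ΓSpecIso S).inv ≫ q.appTop := by
  rw [Category.assoc, ← Scheme.Hom.comp_appTop, h, Scheme.Hom.comp_appTop,
    ← Scheme.ΓSpecIso_inv_naturality_assoc]

lemma LogPair.evalHom_comp_appTop {X Y : Scheme.{u}} {L : Type u} [Field L]
    (x : Spec (.of L) ⟶ X) (g : X ⟶ Y) (h : Γ(Y, ⊤)) :
    evalHom (x ≫ g) ⊤ le_top h = evalHom x ⊤ le_top (g.appTop h) := by
  rw [Scheme.Hom.appTop, Scheme.Hom.app_eq_appLE]
  exact evalHom_comp x g (U := ⊤) (V := ⊤) le_top le_top h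

lemma LogPair.evalHom_appTop_ΓSpecIso_inv {X : Scheme.{u}} {L : Type u} [Field L]
    {R : CommRingCat.{u}} {x : Spec (.of L) ⟶ X} {q : X ⟶ Spec R} {φ : R ⟶ .of L}
    (h : x ≫ q = Spec.map φ) (c : R) :
    evalHom x ⊤ le_top (q.appTop ((Scheme.ΓSpecIso R).inv c)) = φ c := by
  rw [← evalHom_comp_appTop, evalHom_congr h le_top le_top, evalHom_SpecMap]

lemma LogPair.evalHom_appTop_of_comp_eq {X Y : Scheme.{u}} {L : Type u} [Field L]
    {R : CommRingCat.{u}} {x : Spec (.of L) ⟶ X} {p : X ⟶ Y} {φ : R ⟶ .of L} {s : Spec R ⟶ Y}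
    (h : x ≫ p = Spec.map φ ≫ s) (r : Γ(Y, ⊤)) :
    evalHom x ⊤ le_top (p.appTop r) =
      φ ((Scheme.ΓSpecIso R).hom (s.appLE ⊤ ⊤ le_top r)) := by
  rw [← evalHom_comp_appTop, evalHom_congr h le_top le_top]
  exact evalHom_SpecMap_comp φ s le_top le_top r

/-- If `P` is generated by functions coming from `Y` and by constants in the fraction field `F` of
`R`, then the values of a function on `P` at points which extend to `R`-points of `Y` have bounded
denominators. -/
lemma LogPair.exists_mul_evalHom_eq {R F : Type u} [CommRing R] [IsDomain R] [Field F]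
    [Algebra R F] [IsFractionRing R F] {P Y : Scheme.{u}} (p : P ⟶ Y) (q : P ⟶ Spec (.of F))
    (s : Y ⟶ Spec (.of R)) (h : p ≫ s = q ≫ specMap R F)
    (hpq : Subring.closure (Set.range p.appTop ∪ Set.range q.appTop) = ⊤) (g : Γ(P, ⊤)) :
    ∃ a : R, a ≠ 0 ∧ ∀ (x : Spec (.of F) ⟶ P) (y : Spec (.of R) ⟶ Y), x ≫ q = 𝟙 _ →
      x ≫ p = specMap R F ≫ y →
      ∃ b : R, algebraMap R F a * evalHom x ⊤ le_top g = algebraMap R F b := by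
  have ht : p.appTop.hom.comp ((Scheme.ΓSpecIso (.of R)).inv ≫ s.appTop).hom =
      ((Scheme.ΓSpecIso (.of F)).inv ≫ q.appTop).hom.comp (algebraMap R F) :=
    congrArg CommRingCat.Hom.hom (Scheme.Hom.appTop_comp_ΓSpecIso_inv p q s
      (CommRingCat.ofHom (algebraMap R F)) h)
  have hj : Set.range ((Scheme.ΓSpecIso (.of F)).inv ≫ q.appTop).hom = Set.range q.appTop :=
    (Scheme.ΓSpecIso (.of F)).commRingCatIsoToRingEquiv.symm.surjective.range_comp q.appTop
  obtain ⟨a, ha, r, hr⟩ := exists_mul_mem_range_of_closure_eq_top ht (by rw [hj]; exact hpq) g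
  refine ⟨a, ha, fun x y hxq hxp ↦
    ⟨(Scheme.ΓSpecIso (.of R)).hom (y.appLE ⊤ ⊤ le_top r), ?_⟩⟩
  -- `a * g` is the pullback of a function `r` on `Y`, whose value at the `R`-point `y` lies in `R`.
  have h1 := congrArg (evalHom x ⊤ le_top) hr
  have hk : evalHom x ⊤ le_top
      (((Scheme.ΓSpecIso (.of F)).inv ≫ q.appTop).hom (algebraMap R F a)) = algebraMap R F a :=
    evalHom_appTop_ΓSpecIso_inv (φ := 𝟙 (CommRingCat.of F))
      (hxq.trans (Spec.map_id (CommRingCat.of F)).symm) _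
  rw [map_mul, hk] at h1
  rw [h1]
  exact evalHom_appTop_of_comp_eq (φ := CommRingCat.ofHom (algebraMap R F)) hxp r

variable {K : Type u} [Field K] [NumberField K] {X : Scheme.{u}} {f : X ⟶ Spec (.of K)}
  {D : Closeds X}

/-- The model need not be affine; flatness of `K` over `𝓞 K` makes global sections of this
quasi-compact separated scheme commute with base change. -/
lemma LogPair.IntegralModel.closure_range_union_range (M : IntegralModel f D) :
    Subring.closure (Set.range (pullback.fst M.str (specMap (𝓞 K) K)).appTop ∪
      Set.range (pullback.snd M.str (specMap (𝓞 K) K)).appTop) = ⊤ := by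
  have := M.separated
  have := M.quasiCompact
  have hc : CompactSpace M.scheme := QuasiCompact.compactSpace_of_compactSpace M.str
  have hq : QuasiSeparatedSpace M.scheme :=
    (quasiSeparated_iff_quasiSeparatedSpace M.str).mp inferInstance
  have : Flat (specMap (𝓞 K) K) := by
    rw [Flat.SpecMap_iff]
    exact (RingHom.flat_algebraMap_iff).mpr (IsLocalization.flat K (nonZeroDivisors (𝓞 K)))
  have h := CommRingCat.closure_range_union_range_of_isPushout
    ((isIso_pushoutSection_iff (IsPullback.of_hasPullback M.str (specMap (𝓞 K) K)) (US := ⊤)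
      (UT := ⊤) (UX := ⊤) (UY := ⊤) le_top le_top (by simp)).mp
      (isIso_pushoutSection_of_isQuasiSeparated_of_flat_right _ _ _ _ (isAffineOpen_top _)
        (isAffineOpen_top _) isCompact_univ isQuasiSeparated_univ))
  rw [Scheme.Hom.appTop, Scheme.Hom.app_eq_appLE, Scheme.Hom.appTop, Scheme.Hom.app_eq_appLE]
  exact h

/-- The values of a regular function of the generic fibre at integral points have bounded
denominators. -/
lemma LogPair.IntegralModel.exists_denominator (M : IntegralModel f D)
    (g : Γ(pullback M.str (specMap (𝓞 K) K), ⊤)) : ∃ a : 𝓞 K, a ≠ 0 ∧ ∀ s : M.IntPt,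
      ∃ b : 𝓞 K, algebraMap (𝓞 K) K a * evalHom (M.generic s) ⊤ le_top g = algebraMap (𝓞 K) K b := by
  obtain ⟨a, ha, h⟩ := exists_mul_evalHom_eq (R := 𝓞 K) (F := K) _ _ M.str pullback.condition
    M.closure_range_union_range g
  exact ⟨a, ha, fun s ↦ h (M.generic s) s.hom (pullback.lift_snd _ _ _) (pullback.lift_fst _ _ _)⟩

/-- The values of a regular function on `U` at integral points of `U` have bounded denominators. -/
lemma LogPair.IntegralModel.exists_mul_evalHom_toPt_eq (M : IntegralModel f D) {U : X.Opens}
    (hU : openCompl D ≤ U) (h : Γ(X, U)) : ∃ a : 𝓞 K, a ≠ 0 ∧ ∀ s : M.IntPt,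
      ∃ (hs : ⊤ ≤ (M.toPt s).hom ⁻¹ᵁ U) (b : 𝓞 K),
        algebraMap (𝓞 K) K a * evalHom (M.toPt s).hom U hs h = algebraMap (𝓞 K) K b := by
  let i := M.genericFibre.hom ≫ (openCompl D).ι
  have hi : ⊤ ≤ i ⁻¹ᵁ U := fun x _ ↦ hU (M.genericFibre.hom x).2
  obtain ⟨a, ha, hb⟩ := M.exists_denominator (i.appLE U ⊤ hi h)
  refine ⟨a, ha, fun s ↦ ?_⟩
  obtain ⟨b, hb⟩ := hb s
  refine ⟨fun x _ ↦ hi (Set.mem_univ (M.generic s x)), b, ?_⟩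
  exact (congrArg _ (evalHom_comp (M.generic s) i hi le_top h)).trans hb

end Denominators

/-! ### Archimedean completions are locally compact -/

section Completions

instance NumberField.InfinitePlace.Completion.properSpace {K : Type*} [Field K]
    (v : InfinitePlace K) : ProperSpace v.Completion where
  isCompact_closedBall x r := by
    have h := InfinitePlace.Completion.isometry_extensionEmbedding v
    rw [← h.preimage_closedBall]
    exact h.isClosedEmbedding.isCompact_preimage (isCompact_closedBall _ _)

end Completions

/-! ### Finiteness of values and bounds near strata -/

section NeighborhoodsOfStrata

/-- A function which is not constant on an open subset of an integral scheme avoids any given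
finite set of constants on a dense open subset. -/
lemma LogPair.exists_dense_evalHom_notMem {K : Type u} [Field K] {X : Scheme.{u}}
    [AlgebraicGeometry.IsIntegral X] (f : X ⟶ Spec (.of K)) {U : X.Opens} {h : Γ(X, U)}
    (hh : h ∉ Set.range (constants f U)) {S : Set K} (hS : S.Finite) :
    ∃ V : X.Opens, Dense (V : Set X) ∧ ∀ (x : Pt f K) (hx : ⊤ ≤ x.hom ⁻¹ᵁ U),
      x.hom (specPoint K) ∈ V → evalHom x.hom U hx h ∉ S := by
  have hU : Nonempty U := by
    by_contra hU
    -- On the empty open set the ring of functions is zero, so `h` would be constant.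
    have hbot : U = ⊥ := by
      rw [← Opens.not_nonempty_iff_eq_bot]
      exact fun ⟨x, hx⟩ ↦ hU ⟨⟨x, hx⟩⟩
    subst hbot
    exact hh ⟨0, Subsingleton.elim _ _⟩
  let g : Γ(X, U) := ∏ c ∈ hS.toFinset, (h - constants f U c)
  have hg : g ≠ 0 := Finset.prod_ne_zero_iff.mpr fun c _ h0 ↦ hh ⟨c, (sub_eq_zero.mp h0).symm⟩
  refine ⟨X.basicOpen g, (X.basicOpen g).isOpen.dense ?_, fun x hx hxg hxS ↦ ?_⟩
  · by_contra h0
    exact hg ((basicOpen_eq_bot_iff g).mp ((Opens.not_nonempty_iff_eq_bot _).mp h0))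
  · refine (mem_basicOpen_iff_evalHom_ne_zero x.hom hx g).mp hxg ?_
    rw [map_prod]
    refine Finset.prod_eq_zero (hS.mem_toFinset.mpr hxS) ?_
    rw [map_sub, evalHom_constants, Algebra.algebraMap_self, RingHom.id_apply, sub_self]

/-- The elements of a number field with bounded denominators and bounded absolute values at all
archimedean places form a finite set. -/
lemma NumberField.finite_setOf_exists_mul_eq {K : Type*} [Field K] [NumberField K] {a : 𝓞 K}
    (ha : a ≠ 0) (B : InfinitePlace K → ℝ) :
    {c : K | (∃ b : 𝓞 K, algebraMap (𝓞 K) K a * c = algebraMap (𝓞 K) K b) ∧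
      ∀ v : InfinitePlace K, v c ≤ B v}.Finite := by
  obtain ⟨B', hB'⟩ := Finite.exists_le fun v : InfinitePlace K ↦ v (algebraMap (𝓞 K) K a) * B v
  have ha' : algebraMap (𝓞 K) K a ≠ 0 := RingOfIntegers.coe_ne_zero_iff.mpr ha
  -- Multiplication by `a` injects the set into the algebraic integers of `K` with all conjugates
  -- bounded by `B'`.
  refine ((Embeddings.finite_of_norm_le K ℂ B').preimage
    (mul_right_injective₀ ha').injOn).subset ?_
  rintro c ⟨⟨b, hb⟩, hc⟩
  refine ⟨?_, (InfinitePlace.le_iff_le _ _).mp fun v ↦ ?_⟩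
  · change _root_.IsIntegral ℤ (_ * c)
    rw [hb]
    exact RingOfIntegers.isIntegral_coe b
  · rw [map_mul]
    exact (mul_le_mul_of_nonneg_left (hc v) (apply_nonneg v _)).trans (hB' v)

lemma NumberField.InfinitePlace.Completion.norm_algebraMap {K : Type*} [Field K]
    (v : InfinitePlace K) (c : K) : ‖algebraMap K v.Completion c‖ = v c :=
  norm_coe v ((WithAbs.equiv v.1).symm c)

variable {K : Type u} [Field K] {X : Scheme.{u}} {f : X ⟶ Spec (.of K)}

/-- A regular function is bounded on every compact set of rational points at which it is
defined. -/
lemma LogPair.exists_norm_evalHom_lt {L : Type u} [NormedField L] [Algebra K L] {U : X.Opens}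
    (h : Γ(X, U)) {Q : Set (Pt f L)} (hQ : IsCompact Q)
    (hQU : ∀ x ∈ Q, x.hom (specPoint L) ∈ U) :
    ∃ B : ℝ, ∀ x ∈ Q, ∃ hx : ⊤ ≤ x.hom ⁻¹ᵁ U, ‖evalHom x.hom U hx h‖ < B := by
  obtain ⟨n, hn⟩ := hQ.elim_directed_cover
    (fun n : ℕ ↦ {x : Pt f L | ∃ hx : ⊤ ≤ x.hom ⁻¹ᵁ U,
      evalHom x.hom U hx h ∈ Metric.ball (0 : L) n})
    (fun n ↦ isOpen_setOf_evalHom_mem U h Metric.isOpen_ball) (fun x hx ↦ by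
      obtain ⟨n, hn⟩ := exists_nat_gt ‖evalHom x.hom U (top_le_preimage_iff.mpr (hQU x hx)) h‖
      exact Set.mem_iUnion.mpr ⟨n, _, mem_ball_zero_iff.mpr hn⟩)
    (directed_of_isDirected_le fun m n hmn x ⟨hx, hm⟩ ↦
      ⟨hx, Metric.ball_subset_ball (Nat.cast_le.mpr hmn) hm⟩)
  refine ⟨n, fun x hx ↦ ?_⟩
  obtain ⟨hx, hlt⟩ := hn hx
  exact ⟨hx, mem_ball_zero_iff.mp hlt⟩

/-- In general the supremum is the closure of the union; finiteness makes the union closed. -/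
lemma TopologicalSpace.Closeds.coe_sSup_of_finite {T : Type*} [TopologicalSpace T]
    {S : Set (Closeds T)} (hS : S.Finite) :
    ((sSup S : Closeds T) : Set T) = ⋃ Z ∈ S, (Z : Set T) := by
  induction S, hS using Set.Finite.induction_on with
  | empty => simp
  | insert _ _ ih => rw [sSup_insert, Closeds.coe_sup, ih, Set.biUnion_insert]

lemma LogPair.mem_openOfFace_iff [NoetherianSpace X] {D : Closeds X} {Kbar : Type u} [Field Kbar]
    [Algebra K Kbar] {σ : ∀ v : InfinitePlace K, Kbar →ₐ[K] AlgebraicClosure v.Completion}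
    (A : ArchFace f D σ) {x : X} :
    x ∈ openOfFace A ↔ ∀ β ∈ components D, (∀ v, β ∉ (A v).1.verts) → x ∉ β := by
  have hfin := (finite_components D).subset
    (Set.sep_subset (components D) fun α ↦ ∀ v, α ∉ (A v).1.verts)
  change x ∉ ((sSup {α ∈ components D | ∀ v, α ∉ (A v).1.verts} : Closeds X) : Set X) ↔ _
  rw [Closeds.coe_sSup_of_finite hfin]
  simp only [Set.mem_iUnion, not_exists, SetLike.mem_coe]
  exact ⟨fun h β h1 h2 ↦ h β ⟨h1, h2⟩, fun h β h1 ↦ h β h1.1 h1.2⟩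

/-- The points of the stratum of a face away from the strata of all larger faces, for a given place,
have a neighbourhood on which a given function on `U_A` is bounded. -/
lemma LogPair.exists_mem_nhdsSet_norm_evalHom_lt [LocallyOfFiniteType f]
    (hproj : IsProjectiveOver f) {D : Closeds X} (hD : IsSNCDivisor f D) {Kbar : Type u}
    [Field Kbar] [Algebra K Kbar] [IsAlgClosed Kbar]
    {σ : ∀ v : InfinitePlace K, Kbar →ₐ[K] AlgebraicClosure v.Completion} (A : ArchFace f D σ)
    (h : Γ(X, openOfFace A)) (v : InfinitePlace K) {W : AnFace f D (σ v) → Set (Pt f v.Completion)}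
    (hW : ∀ B, A v < B → W B ∈ 𝓝ˢ (ratPts (σ v) B.1.carrier)) :
    ∃ b : ℝ, {x : Pt f v.Completion | ∃ hx, ‖evalHom x.hom (openOfFace A) hx h‖ < b} ∈
      𝓝ˢ (ratPts (σ v) (A v).1.carrier \ ⋃ B : {B // A v < B}, W B.1) := by
  have := hproj.compactSpace
  have : IsLocallyNoetherian X := LocallyOfFiniteType.isLocallyNoetherian f
  have : AlgebraicGeometry.IsNoetherian X := {}
  have := compactSpace_pt hproj (L := v.Completion)
  -- The sets `W B` need not be open; removing only their interiors gives a closed, hence compact,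
  -- set containing the required one.
  let Q := ratPts (σ v) (A v).1.carrier \ ⋃ B : {B // A v < B}, interior (W B.1)
  have hQ : IsCompact Q :=
    ((isClosed_ratPts (σ v) (A v).2.1).sdiff (isOpen_iUnion fun _ ↦ isOpen_interior)).isCompact
  obtain ⟨b, hb⟩ := exists_norm_evalHom_lt h hQ fun x hx ↦ by
    rw [mem_openOfFace_iff]
    intro β hβ hβA hxβ
    obtain ⟨B, hAB, hxB⟩ := exists_lt_mem_ratPts (σ v) hD (A v) x hx.1 hβ (hβA v) hxβ
    exact hx.2 (Set.mem_iUnion.mpr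
      ⟨⟨B, hAB⟩, subset_interior_iff_mem_nhdsSet.mpr (hW B hAB) hxB⟩)
  have hopen : IsOpen {x : Pt f v.Completion |
      ∃ hx, ‖evalHom x.hom (openOfFace A) hx h‖ < b} := by
    simpa only [mem_ball_zero_iff] using
      isOpen_setOf_evalHom_mem (f := f) (openOfFace A) h
        (Metric.isOpen_ball (x := (0 : v.Completion)) (ε := b))
  refine ⟨b, hopen.mem_nhdsSet.mpr fun x hx ↦ hb x ⟨hx.1, fun hx' ↦ hx.2 ?_⟩⟩
  exact Set.iUnion_mono (fun _ ↦ interior_subset) hx'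

end NeighborhoodsOfStrata

theorem proposition2p5 {K : Type u} [Field K] [NumberField K]
    {X : Scheme.{u}} (f : X ⟶ Spec (.of K))
    [Smooth f] [GeometricallyIntegral f] (hproj : IsProjectiveOver f)
    (D : Closeds X) (hD : IsSNCDivisor f D)
    {Kbar : Type u} [Field Kbar] [Algebra K Kbar] [IsAlgClosure K Kbar]
    (hsplit : ComponentsDefinedOver f D Kbar)
    (σ : ∀ v : InfinitePlace K, Kbar →ₐ[K] AlgebraicClosure v.Completion)
    (M : IntegralModel f D)
    (A : ArchFace f D σ)
    (hA : ¬ Function.Surjective (constants f (openOfFace A)))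
    (W : ∀ v : InfinitePlace K, AnFace f D (σ v) → Set (Pt f v.Completion))
    (hW : ∀ (v : InfinitePlace K) (B : AnFace f D (σ v)), A v < B →
      W v B ∈ 𝓝ˢ (ratPts (σ v) B.1.carrier)) :
    ∃ (N : ∀ v : InfinitePlace K, Set (Pt f v.Completion)) (V : X.Opens),
      (∀ v, N v ∈ 𝓝ˢ (ratPts (σ v) (A v).1.carrier \ ⋃ B : {B // A v < B}, W v B.1)) ∧
      Dense (V : Set X) ∧
      {x : Pt f K | x ∈ Set.range M.toPt ∧ Set.range x.hom ⊆ (V : Set X) ∧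
        ∀ v : InfinitePlace K, x.extend v.Completion ∈ N v} = ∅ := by
  have := IsAlgClosure.isAlgClosed K (K := Kbar)
  have : Subsingleton (Spec (.of K)) := inferInstanceAs (Subsingleton (PrimeSpectrum K))
  have : AlgebraicGeometry.IsIntegral X := GeometricallyIntegral.isIntegral_of_subsingleton f
  obtain ⟨h, hh⟩ := not_forall.mp hA
  have hDU : openCompl D ≤ openOfFace A := by
    have hle : sSup {α ∈ components D | ∀ v, α ∉ (A v).1.verts} ≤ D :=
      sSup_le fun α hα ↦ le_of_mem_components hα.1
    exact fun x hx hx' ↦ hx (hle hx')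
  obtain ⟨a, ha, hint⟩ := M.exists_mul_evalHom_toPt_eq hDU h
  choose b hb using fun v ↦ exists_mem_nhdsSet_norm_evalHom_lt hproj hD A h v (hW v)
  -- The finite set consists of all values that `h` could take at an integral point satisfying the
  -- bounds `b v`.
  obtain ⟨V, hV, hVh⟩ := exists_dense_evalHom_notMem f hh (finite_setOf_exists_mul_eq ha b)
  refine ⟨_, V, hb, hV, Set.eq_empty_iff_forall_notMem.mpr ?_⟩
  rintro _ ⟨⟨s, rfl⟩, hsV, hsN⟩
  obtain ⟨hs, b, hb⟩ := hint s
  refine hVh (M.toPt s) hs (hsV ⟨_, rfl⟩) ⟨⟨b, hb⟩, fun v ↦ ?_⟩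
  obtain ⟨hx, hlt⟩ := hsN v
  rw [evalHom_extend (M.toPt s) hs hx, InfinitePlace.Completion.norm_algebraMap] at hlt
  exact hlt.le
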